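/- Let $(E,C)$ be a finite bipartite separated graph: $E^0=E^{0,0}\sqcup E^{0,1}$ and $E^1$ are finite, every edge $e$ goes from $s(e)\in E^{0,1}$ to $r(e)\in E^{0,0}$, and for each $v\in E^{0,0}$, $C_v$ is a partition of $r^{-1}(v)$ into nonempty subsets. Assume $s(E^1)=E^{0,1}$ and $r(E^1)=E^{0,0}$. Put $C=\bigsqcup_v C_v$ and, for $e\in E^1$, let $X_e$ be the element of $C$ containing $e$. Let $\mathbb F$ be the free group on $E^1$, with word length $|\cdot|$, and let $\Omega(E,C)\subseteq 2^{\mathbb F}$ (with the subspace topology of the product topology) be the space of all subsets $\xi\subseteq\mathbb F$ such that $1\in\xi$; $\xi$ is convex, that is, $g,h\in\xi$ and $|g^{-1}h|=|g^{-1}k|+|k^{-1}h|$ imply $k\in\xi$; and for each $g\in\xi$ the set $\xi_g=\{x\in E^1\cup (E^1)^{-1}: gx\in\xi\}$ is either $\{e^{-1}: s(e)=w\}$ for some $w\in E^{0,1}$, or consists of exactly one element of each $X\in C_v$ (and nothing more) for some $v\in E^{0,0}$. (This is the universal $(E,C)$-dynamical system.) The canonical partial action $\theta$ of $\mathbb F$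 on $\Omega(E,C)$ is given by $\Omega_g=\{\xi: g\in\xi\}$ and the homeomorphisms $\theta_g\colon\Omega_{g^{-1}}\to\Omega_g$, $\theta_g(\xi)=g\xi$. It is called topologically free if for every $g\in\mathbb F\setminus\{1\}$ the set $\{\xi\in\Omega_{g^{-1}}:\theta_g(\xi)=\xi\}$ has empty interior. In the double graph of $E$ (for each $e\in E^1$ adjoin a reversed edge $e^*$), a path $\cdots e_4^*e_3e_2^*e_1$ (ending in a starred or an unstarred edge) is admissible if $r(e_{2i-1})=r(e_{2i})$ and $X_{e_{2i-1}}\neq X_{e_{2i}}$, and $s(e_{2i})=s(e_{2i+1})$ and $e_{2i}\neq e_{2i+1}$, for all $i$ for which both edges occur in the path. A closed path is an admissible path $\gamma=e_{2r}^*e_{2r-1}\cdots e_2^*e_1$ with $r\ge 1$ and $s(e_1)=s(e_{2r})$; it is a cycle if in addition $e_1\ne e_{2r}$ and $s(e_{2i-1})\ne s(e_{2j})$ for all $1\le i\le j<r$. An entry of $\gamma$ is an admissible path $x_{2t-1}x_{2t-2}^*\cdots x_2^*x_1$ with $t\ge1$ and $s(x_1)=s(e_1)$ such that $|X|\ge2$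 for some $X\in C_{r(x_{2t-1})}$ with $X\ne X_{x_{2t-1}}$. The pair $(E,C)$ satisfies condition (L) if every cycle has an entry. Then the canonical partial action of $\mathbb F$ on $\Omega(E,C)$ is topologically free if and only if $(E,C)$ satisfies condition (L). -/

import Mathlib

open Set Topology

/-! ### Bipartite separated graphs -/

/-- A bipartite separated graph `(E, C)`. The vertex set is `E⁰ = E^{0,0} ⊔ E^{0,1}`, with
`V₀ = E^{0,0}` and `V₁ = E^{0,1}`; the edge set is `E¹`, and each edge `e` goes from `s e ∈ V₁` to
`r e ∈ V₀`. For `v ∈ V₀`, `C v` is a partition of `r⁻¹(v)` into nonempty subsets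
(vertices in `V₁` receive no edges, so that their families `C_w` are empty and are omitted).
As usual for bipartite separated graphs, `s(E¹) = E^{0,1}` and `r(E¹) = E^{0,0}`. -/
structure BipartiteSeparatedGraph (V₀ V₁ E : Type*) where
  r : E → V₀
  s : E → V₁
  C : V₀ → Set (Set E)
  empty_notMem : ∀ v, ∅ ∉ C v
  sUnion_C : ∀ v, ⋃₀ C v = {e | r e = v}
  pairwiseDisjoint_C : ∀ v, (C v).PairwiseDisjoint id
  s_surjective : Function.Surjective s
  r_surjective : Function.Surjective r

namespace BipartiteSeparatedGraph

variable {V₀ V₁ E : Type*} (G : BipartiteSeparatedGraph V₀ V₁ E)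

theorem exists_part (e : E) : ∃ X ∈ G.C (G.r e), e ∈ X := by
  have h : e ∈ ⋃₀ G.C (G.r e) := by rw [G.sUnion_C]; rfl
  exact h

/-- The unique element `X_e` of `C` that contains the edge `e`. -/
noncomputable def part (e : E) : Set E := (G.exists_part e).choose

theorem part_mem (e : E) : G.part e ∈ G.C (G.r e) := (G.exists_part e).choose_spec.1

theorem mem_part (e : E) : e ∈ G.part e := (G.exists_part e).choose_spec.2

theorem r_eq_of_mem {v : V₀} {X : Set E} (hX : X ∈ G.C v) {e : E} (he : e ∈ X) : G.r e = v := by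
  have h : e ∈ ⋃₀ G.C v := ⟨X, hX, he⟩
  rw [G.sUnion_C] at h
  exact h

theorem exists_mem_C (v : V₀) : ∃ X, X ∈ G.C v := by
  obtain ⟨e, rfl⟩ := G.r_surjective v
  exact ⟨_, G.part_mem e⟩

/-! ### Paths in the double graph and condition (L) -/

/-- The sequence of edges `e 1, e 2, …, e n` gives an admissible path
`⋯ e₄^* e₃ e₂^* e₁` with `n` edges in the double of `E`, starting at the vertex `s (e 1)` of
`E^{0,1}`; the edges with an odd index are travelled forwards, those with an even index backwards.
(The values of `e` outside `{1, …, n}` play no role.) -/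
def IsAdmissible (e : ℕ → E) (n : ℕ) : Prop :=
  (∀ i, 1 ≤ i → i < n → Odd i →
    G.r (e i) = G.r (e (i + 1)) ∧ G.part (e i) ≠ G.part (e (i + 1))) ∧
  (∀ i, 1 ≤ i → i < n → Even i →
    G.s (e i) = G.s (e (i + 1)) ∧ e i ≠ e (i + 1))

/-- A closed path `e_{2k}^* e_{2k-1} ⋯ e₂^* e₁`, `k ≥ 1`. -/
def IsClosedPath (e : ℕ → E) (k : ℕ) : Prop :=
  1 ≤ k ∧ G.IsAdmissible e (2 * k) ∧ G.s (e 1) = G.s (e (2 * k))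

/-- A cycle `e_{2k}^* e_{2k-1} ⋯ e₂^* e₁`. -/
def IsCycle (e : ℕ → E) (k : ℕ) : Prop :=
  G.IsClosedPath e k ∧ e 1 ≠ e (2 * k) ∧
    ∀ i j, 1 ≤ i → i ≤ j → j < k → G.s (e (2 * i - 1)) ≠ G.s (e (2 * j))

/-- The path `x_{2t-1} x_{2t-2}^* ⋯ x₂^* x₁`, `t ≥ 1`, is an entry of the closed path with first
edge `e 1`. -/
def IsEntry (x : ℕ → E) (t : ℕ) (e : ℕ → E) : Prop :=
  1 ≤ t ∧ G.IsAdmissible x (2 * t - 1) ∧ G.s (x 1) = G.s (e 1) ∧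
    ∃ X ∈ G.C (G.r (x (2 * t - 1))), 2 ≤ X.encard ∧ X ≠ G.part (x (2 * t - 1))

/-- Condition (L): every cycle has an entry. -/
def ConditionL : Prop :=
  ∀ (e : ℕ → E) (k : ℕ), G.IsCycle e k → ∃ (x : ℕ → E) (t : ℕ), G.IsEntry x t e

end BipartiteSeparatedGraph

/-! ### Partial actions on topological spaces -/

/-- A partial action of a group `Γ` on a topological space `X`: open sets `U g` and
homeomorphisms `θ g : U g⁻¹ → U g`. -/
structure TopPartialAction (Γ : Type*) [Group Γ] (X : Type*) [TopologicalSpace X] where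
  U : Γ → Set X
  isOpen_U : ∀ g, IsOpen (U g)
  θ : ∀ g, U g⁻¹ ≃ₜ U g
  U_one : U 1 = univ
  θ_one : ∀ x (hx : x ∈ U 1⁻¹), (θ 1 ⟨x, hx⟩ : X) = x
  image_inter : ∀ h g,
    {y | ∃ x, ∃ hx : x ∈ U h⁻¹, x ∈ U g ∧ (θ h ⟨x, hx⟩ : X) = y} = U h ∩ U (h * g)
  θ_mul : ∀ g h x (hx : x ∈ U h⁻¹) (hy : (θ h ⟨x, hx⟩ : X) ∈ U g⁻¹) (hz : x ∈ U (g * h)⁻¹),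
    (θ g ⟨θ h ⟨x, hx⟩, hy⟩ : X) = θ (g * h) ⟨x, hz⟩

/-- The partial action `A` is topologically free: for all `t ≠ 1` the set of fixed points
`F_t = {x ∈ U_{t⁻¹} | θ_t(x) = x}` has empty interior. -/
def TopPartialAction.IsTopologicallyFree {Γ : Type*} [Group Γ] {X : Type*} [TopologicalSpace X]
    (A : TopPartialAction Γ X) : Prop :=
  ∀ t : Γ, t ≠ 1 → interior {x | ∃ hx : x ∈ A.U t⁻¹, (A.θ t ⟨x, hx⟩ : X) = x} = ∅

namespace BipartiteSeparatedGraph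

/-! ### The space `Ω(E, C)` as a space of configurations -/

/-- The length of `g` as a reduced word in the free generators and their inverses. -/
noncomputable def wordLength {E : Type*} (g : FreeGroup E) : ℕ :=
  letI := Classical.decEq E
  g.norm

variable {V₀ V₁ E : Type*} (G : BipartiteSeparatedGraph V₀ V₁ E)

/-- A subset `ξ` of the free group on `E¹` (given by its indicator function) has a local
configuration of type `v` at `g`. If `v ∈ E^{0,1}`, the neighbours of `g` in `ξ` are exactly the
`g e⁻¹` with `s(e) = v`. If `v ∈ E^{0,0}`, they are of the form `g e` with `r(e) = v`,
exactly one `e` for each `X ∈ C_v`. -/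
def HasLocalType (ξ : FreeGroup E → Bool) (g : FreeGroup E) : V₀ ⊕ V₁ → Prop
  | .inl v =>
    (∀ e, ξ (g * (FreeGroup.of e)⁻¹) = false) ∧
    (∀ e, ξ (g * FreeGroup.of e) = true → G.r e = v) ∧
    ∀ X ∈ G.C v, ∃! e, e ∈ X ∧ ξ (g * FreeGroup.of e) = true
  | .inr w =>
    (∀ e, ξ (g * (FreeGroup.of e)⁻¹) = true ↔ G.s e = w) ∧
    ∀ e, ξ (g * FreeGroup.of e) = false

/-- The configurations: the subsets of the free group on `E¹` (given by their indicator function)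
that contain `1`, are convex, and have a local configuration of the type of some vertex at each
of their elements. -/
structure IsConfiguration (ξ : FreeGroup E → Bool) : Prop where
  one_mem : ξ 1 = true
  convex : ∀ g h k, ξ g = true → ξ h = true →
    wordLength (g⁻¹ * h) = wordLength (g⁻¹ * k) + wordLength (k⁻¹ * h) → ξ k = true
  localType : ∀ g, ξ g = true → ∃ v, G.HasLocalType ξ g v

/-- The space `Ω(E, C)`, with the topology of pointwise convergence (the subspace topology of
`2^𝔽`, where `𝔽` is the free group on `E¹`). -/
abbrev Omega : Type _ := {ξ : FreeGroup E → Bool // G.IsConfiguration ξ}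

/-- The translate `g ξ` of a subset `ξ` of the free group. -/
def translate (g : FreeGroup E) (ξ : FreeGroup E → Bool) : FreeGroup E → Bool :=
  fun h => ξ (g⁻¹ * h)

theorem hasLocalType_translate (g : FreeGroup E) (ξ : FreeGroup E → Bool) (h : FreeGroup E)
    (v : V₀ ⊕ V₁) : G.HasLocalType (translate g ξ) h v ↔ G.HasLocalType ξ (g⁻¹ * h) v := by
  cases v <;> simp [HasLocalType, translate, mul_assoc]

theorem IsConfiguration.translate {ξ : FreeGroup E → Bool} (hξ : G.IsConfiguration ξ)
    {g : FreeGroup E} (hg : ξ g⁻¹ = true) : G.IsConfiguration (translate g ξ) where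
  one_mem := by simpa [BipartiteSeparatedGraph.translate] using hg
  convex := by
    intro a b k ha hb hab
    refine hξ.convex (g⁻¹ * a) (g⁻¹ * b) (g⁻¹ * k) ha hb ?_
    simpa [mul_assoc] using hab
  localType := by
    intro h hh
    obtain ⟨v, hv⟩ := hξ.localType _ hh
    exact ⟨v, (G.hasLocalType_translate g ξ h v).2 hv⟩

/-- The clopen set `U_g = {ξ ∈ Ω(E, C) | g ∈ ξ}`. -/
def omegaSet (g : FreeGroup E) : Set G.Omega := {ξ | ξ.1 g = true}

theorem continuous_omega_apply (g : FreeGroup E) : Continuous fun ξ : G.Omega => ξ.1 g :=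
  (continuous_apply g).comp continuous_subtype_val

theorem mem_omegaSet {g : FreeGroup E} {ξ : G.Omega} : ξ ∈ G.omegaSet g ↔ ξ.1 g = true := Iff.rfl

theorem isClopen_omegaSet (g : FreeGroup E) : IsClopen (G.omegaSet g) :=
  (isClopen_discrete {true}).preimage (G.continuous_omega_apply g)

/-- The point `g ξ` of `Ω(E, C)`, for `ξ ∈ Ω(E, C)` with `g⁻¹ ∈ ξ`. -/
def Omega.smul {G : BipartiteSeparatedGraph V₀ V₁ E} (g : FreeGroup E) (ξ : G.Omega)
    (hg : ξ ∈ G.omegaSet g⁻¹) : G.Omega :=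
  ⟨translate g ξ.1, ξ.2.translate G hg⟩

theorem Omega.ext {G : BipartiteSeparatedGraph V₀ V₁ E} {ξ η : G.Omega}
    (h : ∀ g, ξ.1 g = η.1 g) : ξ = η :=
  Subtype.ext (funext h)

theorem Omega.smul_apply {G : BipartiteSeparatedGraph V₀ V₁ E} (g : FreeGroup E) (ξ : G.Omega)
    (hg : ξ ∈ G.omegaSet g⁻¹) (h : FreeGroup E) : (Omega.smul g ξ hg).1 h = ξ.1 (g⁻¹ * h) :=
  rfl

/-- The homeomorphism `θ_g : U_{g⁻¹} → U_g`, `θ_g(ξ) = g ξ`. -/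
def translateHomeomorph (g : FreeGroup E) : G.omegaSet g⁻¹ ≃ₜ G.omegaSet g where
  toFun ξ := ⟨Omega.smul g ξ.1 ξ.2, by
    rw [mem_omegaSet, Omega.smul_apply, inv_mul_cancel]; exact ξ.1.2.one_mem⟩
  invFun ξ := ⟨Omega.smul g⁻¹ ξ.1 (by rw [inv_inv]; exact ξ.2), by
    rw [mem_omegaSet, Omega.smul_apply, inv_mul_cancel]; exact ξ.1.2.one_mem⟩
  left_inv ξ := by
    apply Subtype.ext; apply Omega.ext; intro h
    simp [Omega.smul_apply]
  right_inv ξ := by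
    apply Subtype.ext; apply Omega.ext; intro h
    simp [Omega.smul_apply]
  continuous_toFun := by
    refine Continuous.subtype_mk (Continuous.subtype_mk (continuous_pi fun h => ?_) _) _
    exact (G.continuous_omega_apply (g⁻¹ * h)).comp continuous_subtype_val
  continuous_invFun := by
    refine Continuous.subtype_mk (Continuous.subtype_mk (continuous_pi fun h => ?_) _) _
    exact (G.continuous_omega_apply (g⁻¹⁻¹ * h)).comp continuous_subtype_val

theorem translateHomeomorph_apply (g : FreeGroup E) (ξ : G.omegaSet g⁻¹) :
    (G.translateHomeomorph g ξ : G.Omega) = Omega.smul g ξ.1 ξ.2 :=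
  rfl

/-- The canonical partial action of the free group `𝔽` on `E¹` on the space `Ω(E, C)`:
`U_g = {ξ | g ∈ ξ}`, and `θ_g(ξ) = g ξ` for `ξ ∈ U_{g⁻¹}`. -/
def canonicalPartialAction : TopPartialAction (FreeGroup E) G.Omega where
  U := G.omegaSet
  isOpen_U g := (G.isClopen_omegaSet g).isOpen
  θ := G.translateHomeomorph
  U_one := by
    ext ξ
    exact iff_of_true ξ.2.one_mem trivial
  θ_one := by
    intro ξ hξ
    apply Omega.ext; intro h
    simp [translateHomeomorph_apply, Omega.smul_apply]
  image_inter := by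
    intro h g
    ext η
    constructor
    · rintro ⟨ξ, hξ, hg, rfl⟩
      refine ⟨(G.translateHomeomorph h ⟨ξ, hξ⟩).2, ?_⟩
      rw [translateHomeomorph_apply, mem_omegaSet, Omega.smul_apply, inv_mul_cancel_left]; exact hg
    · rintro ⟨h1, h2⟩
      refine ⟨_, ((G.translateHomeomorph h).symm ⟨η, h1⟩).2, ?_, ?_⟩
      · change Omega.smul h⁻¹ η (by rw [inv_inv]; exact h1) ∈ G.omegaSet g
        rw [mem_omegaSet, Omega.smul_apply, inv_inv]; exact h2
      · exact congrArg Subtype.val ((G.translateHomeomorph h).apply_symm_apply ⟨η, h1⟩)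
  θ_mul := by
    intro g h ξ hx hy hz
    apply Omega.ext; intro k
    simp [translateHomeomorph_apply, Omega.smul_apply, mul_assoc]

/-! ### `(E, C)`-dynamical systems -/

/-- An `(E, C)`-dynamical system: a compact Hausdorff space `Ω` that is the disjoint union of clopen
subsets `Ω_v` (`v ∈ E⁰`), with clopen subsets `H_x` (`x ∈ E¹`) such that `Ω_v = ⨆_{x ∈ X} H_x` for
all `X ∈ C_v`, and with homeomorphisms `θ_x : Ω_{s(x)} → H_x`. -/
structure DynamicalSystem.{w, u₀, u₁, u₂} {V₀ : Type u₀} {V₁ : Type u₁} {E : Type u₂}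
    (G : BipartiteSeparatedGraph V₀ V₁ E) where
  carrier : Type w
  [top : TopologicalSpace carrier]
  [compact : CompactSpace carrier]
  [t2 : T2Space carrier]
  Ω : V₀ ⊕ V₁ → Set carrier
  isClopen_Ω : ∀ v, IsClopen (Ω v)
  disjoint_Ω : ∀ v v', v ≠ v' → Disjoint (Ω v) (Ω v')
  iUnion_Ω : ⋃ v, Ω v = univ
  H : E → Set carrier
  isClopen_H : ∀ x, IsClopen (H x)
  disjoint_H : ∀ v, ∀ X ∈ G.C v, X.PairwiseDisjoint H
  biUnion_H : ∀ v, ∀ X ∈ G.C v, ⋃ x ∈ X, H x = Ω (.inl v)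
  θ : ∀ x, Ω (.inr (G.s x)) ≃ₜ H x

attribute [instance] DynamicalSystem.top DynamicalSystem.compact DynamicalSystem.t2

namespace DynamicalSystem

universe w w' u₀ u₁ u₂

variable {V₀ : Type u₀} {V₁ : Type u₁} {E : Type u₂} {G : BipartiteSeparatedGraph V₀ V₁ E}

/-- Equivariant maps between `(E, C)`-dynamical systems. -/
structure IsEquivariant (S : DynamicalSystem.{w} G) (T : DynamicalSystem.{w'} G)
    (f : S.carrier → T.carrier) : Prop where
  map_Ω : ∀ v, MapsTo f (S.Ω v) (T.Ω v)
  map_H : ∀ x, MapsTo f (S.H x) (T.H x)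
  map_θ : ∀ x y (hy : y ∈ S.Ω (.inr (G.s x))),
    f (S.θ x ⟨y, hy⟩) = T.θ x ⟨f y, map_Ω _ hy⟩

/-- The universal `(E, C)`-dynamical system: every `(E, C)`-dynamical system has a unique
continuous equivariant map to it. -/
def IsUniversal (T : DynamicalSystem.{w'} G) : Prop :=
  ∀ S : DynamicalSystem.{w} G, ∃! f : S.carrier → T.carrier, Continuous f ∧ IsEquivariant S T f

end DynamicalSystem

section words

variable {E : Type*}

/-- The reduced word of `g`. -/
noncomputable def redWord (g : FreeGroup E) : List (E × Bool) :=
  letI := Classical.decEq E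
  g.toWord

theorem wordLength_eq (g : FreeGroup E) : wordLength g = (redWord g).length := rfl

theorem mk_redWord (g : FreeGroup E) : FreeGroup.mk (redWord g) = g :=
  letI := Classical.decEq E
  FreeGroup.mk_toWord

theorem red_redWord (L : List (E × Bool)) : FreeGroup.Red L (redWord (FreeGroup.mk L)) :=
  letI := Classical.decEq E
  FreeGroup.reduce.red

theorem redWord_one : redWord (1 : FreeGroup E) = [] :=
  letI := Classical.decEq E
  FreeGroup.toWord_one

theorem redWord_inv (g : FreeGroup E) : redWord g⁻¹ = FreeGroup.invRev (redWord g) :=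
  letI := Classical.decEq E
  FreeGroup.toWord_inv g

theorem redWord_singleton (a : E × Bool) : redWord (FreeGroup.mk [a]) = [a] :=
  letI := Classical.decEq E
  FreeGroup.reduce_singleton a

theorem redWord_mul {g h : FreeGroup E}
    (hl : wordLength (g * h) = wordLength g + wordLength h) :
    redWord (g * h) = redWord g ++ redWord h :=
  letI := Classical.decEq E
  (FreeGroup.toWord_mul_sublist g h).eq_of_length (by
    rw [List.length_append]; exact hl)

theorem redWord_cons {g : FreeGroup E} {a : E × Bool} {L : List (E × Bool)}
    (h : redWord g = a :: L) : redWord (FreeGroup.mk L) = L := by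
  let _ := Classical.decEq E
  have h1 : FreeGroup.IsReduced g.toWord := FreeGroup.isReduced_toWord
  have h2 : g.toWord = a :: L := h
  rw [h2] at h1
  exact (h1.infix (List.suffix_cons a L).isInfix).reduce_eq

end words

namespace DynamicalSystem

universe w w' u₀ u₁ u₂

variable {V₀ : Type u₀} {V₁ : Type u₁} {E : Type u₂} {G : BipartiteSeparatedGraph V₀ V₁ E}
  (S : DynamicalSystem.{w} G)

theorem exists_mem_Ω (y : S.carrier) : ∃ v, y ∈ S.Ω v := by
  have h : y ∈ ⋃ v, S.Ω v := by rw [S.iUnion_Ω]; trivial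
  simpa using h

theorem eq_of_mem_Ω {y : S.carrier} {v v' : V₀ ⊕ V₁} (h : y ∈ S.Ω v) (h' : y ∈ S.Ω v') :
    v = v' := by
  by_contra hne
  exact (Set.disjoint_left.1 (S.disjoint_Ω v v' hne)) h h'

theorem mem_Ω_of_mem_H {y : S.carrier} {x : E} (h : y ∈ S.H x) : y ∈ S.Ω (.inl (G.r x)) := by
  rw [← S.biUnion_H _ _ (G.part_mem x)]
  exact Set.mem_biUnion (G.mem_part x) h

theorem exists_mem_H {y : S.carrier} {v : V₀} (h : y ∈ S.Ω (.inl v)) {X : Set E}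
    (hX : X ∈ G.C v) : ∃ x ∈ X, y ∈ S.H x := by
  rw [← S.biUnion_H _ _ hX] at h
  simpa using h

theorem eq_of_mem_H {y : S.carrier} {v : V₀} {X : Set E} (hX : X ∈ G.C v) {x x' : E}
    (hx : x ∈ X) (hx' : x' ∈ X) (h : y ∈ S.H x) (h' : y ∈ S.H x') : x = x' := by
  by_contra hne
  exact (Set.disjoint_left.1 (S.disjoint_H v X hX hx hx' hne)) h h'

/-- `Step (x, true) y z` means `y = θ_x(z)` and `Step (x, false) y z` means `z = θ_x(y)`. -/
def Step : E × Bool → S.carrier → S.carrier → Prop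
  | (x, false), y, z => ∃ hy : y ∈ S.Ω (.inr (G.s x)), (S.θ x ⟨y, hy⟩ : S.carrier) = z
  | (x, true), y, z => ∃ hz : z ∈ S.Ω (.inr (G.s x)), (S.θ x ⟨z, hz⟩ : S.carrier) = y

theorem step_symm {x : E} {b : Bool} {y z : S.carrier} (h : S.Step (x, b) y z) :
    S.Step (x, !b) z y := by
  cases b <;> exact h

theorem step_unique {a : E × Bool} {y z z' : S.carrier} (h : S.Step a y z) (h' : S.Step a y z') :
    z = z' := by
  obtain ⟨x, b⟩ := a
  cases b
  · obtain ⟨h1, rfl⟩ := h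
    obtain ⟨h2, rfl⟩ := h'
    rfl
  · obtain ⟨h1, h3⟩ := h
    obtain ⟨h2, h4⟩ := h'
    have := (S.θ x).injective (Subtype.ext (h3.trans h4.symm))
    exact congrArg Subtype.val this

theorem exists_step_false {x : E} {y : S.carrier} :
    (∃ z, S.Step (x, false) y z) ↔ y ∈ S.Ω (.inr (G.s x)) :=
  ⟨fun ⟨_, h, _⟩ => h, fun h => ⟨_, h, rfl⟩⟩

theorem exists_step_true {x : E} {y : S.carrier} :
    (∃ z, S.Step (x, true) y z) ↔ y ∈ S.H x := by
  constructor
  · rintro ⟨z, hz, rfl⟩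
    exact (S.θ x ⟨z, hz⟩).2
  · intro h
    exact ⟨_, ((S.θ x).symm ⟨y, h⟩).2, congrArg Subtype.val ((S.θ x).apply_symm_apply ⟨y, h⟩)⟩

/-- `Run L y z` means that `z` is reached from `y` by the successive steps in the list `L`. -/
def Run : List (E × Bool) → S.carrier → S.carrier → Prop
  | [], y, z => y = z
  | a :: L, y, z => ∃ u, S.Step a y u ∧ Run L u z

theorem run_singleton {a : E × Bool} {y z : S.carrier} : S.Run [a] y z ↔ S.Step a y z := by
  simp [Run]

theorem run_append {L L' : List (E × Bool)} {y z : S.carrier} :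
    S.Run (L ++ L') y z ↔ ∃ u, S.Run L y u ∧ S.Run L' u z := by
  induction L generalizing y with
  | nil => simp [Run]
  | cons a L ih =>
    simp only [List.cons_append, Run, ih]
    constructor
    · rintro ⟨u, h1, v, h2, h3⟩
      exact ⟨v, ⟨u, h1, h2⟩, h3⟩
    · rintro ⟨v, ⟨u, h1, h2⟩, h3⟩
      exact ⟨u, h1, v, h2, h3⟩

theorem run_unique {L : List (E × Bool)} {y z z' : S.carrier} (h : S.Run L y z)
    (h' : S.Run L y z') : z = z' := by
  induction L generalizing y with
  | nil => exact h.symm.trans h'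
  | cons a L ih =>
    obtain ⟨u, h1, h2⟩ := h
    obtain ⟨u', h3, h4⟩ := h'
    obtain rfl := S.step_unique h1 h3
    exact ih h2 h4

theorem run_red {L L' : List (E × Bool)} (hr : FreeGroup.Red L L') {y z : S.carrier}
    (h : S.Run L y z) : S.Run L' y z := by
  induction hr with
  | refl => exact h
  | tail _ hs ih =>
    cases hs with
    | not =>
      obtain ⟨u, h1, v, h2, t, h3, h4⟩ := S.run_append.1 ih
      obtain rfl := S.step_unique (S.step_symm h2) h3
      exact S.run_append.2 ⟨_, h1, h4⟩

theorem run_invRev {L : List (E × Bool)} {y z : S.carrier} (h : S.Run L y z) :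
    S.Run (FreeGroup.invRev L) z y := by
  induction L generalizing y with
  | nil => exact Eq.symm h
  | cons a L ih =>
    obtain ⟨u, h1, h2⟩ := h
    rw [FreeGroup.invRev_cons]
    refine S.run_append.2 ⟨u, ih h2, ?_⟩
    exact S.run_singleton.2 (S.step_symm h1)

/-- `Move g y z` means that `z = θ_{g⁻¹}(y)`, where `θ_{g⁻¹}` is the composition of the maps
`θ_x^{±1}` along the reduced word of `g⁻¹`. -/
def Move (g : FreeGroup E) (y z : S.carrier) : Prop := S.Run (redWord g) y z

theorem move_mul {g h : FreeGroup E} {y z u : S.carrier} (h1 : S.Move g y z) (h2 : S.Move h z u) :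
    S.Move (g * h) y u := by
  have h3 : S.Run (redWord g ++ redWord h) y u := S.run_append.2 ⟨z, h1, h2⟩
  have h4 := S.run_red (red_redWord _) h3
  rwa [← FreeGroup.mul_mk, mk_redWord, mk_redWord] at h4

theorem move_inv {g : FreeGroup E} {y z : S.carrier} (h : S.Move g y z) : S.Move g⁻¹ z y := by
  have := S.run_invRev h
  rwa [← redWord_inv] at this

theorem move_of {x : E} {y z : S.carrier} :
    S.Move (FreeGroup.of x) y z ↔ S.Step (x, true) y z := by
  change S.Run (redWord (FreeGroup.mk [(x, true)])) y z ↔ _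
  rw [redWord_singleton, run_singleton]

theorem move_of_inv {x : E} {y z : S.carrier} :
    S.Move (FreeGroup.of x)⁻¹ y z ↔ S.Step (x, false) y z := by
  change S.Run (redWord (FreeGroup.mk [(x, false)])) y z ↔ _
  rw [redWord_singleton, run_singleton]

open scoped Classical in
/-- The configuration of a point: the set of all `g` such that the point is in the range of
`θ_g`. -/
noncomputable def config (y : S.carrier) : FreeGroup E → Bool := fun g => decide (∃ z, S.Move g y z)

theorem config_eq_true {y : S.carrier} {g : FreeGroup E} :
    S.config y g = true ↔ ∃ z, S.Move g y z := by
  simp [config]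

theorem config_mul {y z : S.carrier} {g : FreeGroup E} (h : S.Move g y z) (k : FreeGroup E) :
    S.config y (g * k) = S.config z k := by
  rw [Bool.eq_iff_iff, config_eq_true, config_eq_true]
  constructor
  · rintro ⟨u, hu⟩
    exact ⟨u, by simpa using S.move_mul (S.move_inv h) hu⟩
  · rintro ⟨u, hu⟩
    exact ⟨u, S.move_mul h hu⟩

theorem config_of {y : S.carrier} {x : E} :
    S.config y (FreeGroup.of x) = true ↔ y ∈ S.H x := by
  rw [config_eq_true, ← exists_step_true]
  simp only [move_of]

theorem config_of_inv {y : S.carrier} {x : E} :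
    S.config y (FreeGroup.of x)⁻¹ = true ↔ y ∈ S.Ω (.inr (G.s x)) := by
  rw [config_eq_true, ← exists_step_false]
  simp only [move_of_inv]

theorem config_localType_one {y : S.carrier} {v : V₀ ⊕ V₁} (hy : y ∈ S.Ω v) :
    G.HasLocalType (S.config y) 1 v := by
  cases v with
  | inl v =>
    refine ⟨fun e => ?_, fun e he => ?_, fun X hX => ?_⟩
    · rw [one_mul, Bool.eq_false_iff, Ne, config_of_inv]
      intro h
      exact absurd (S.eq_of_mem_Ω h hy) (by simp)
    · rw [one_mul, config_of] at he
      simpa using S.eq_of_mem_Ω (S.mem_Ω_of_mem_H he) hy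
    · obtain ⟨x, hx, hyx⟩ := S.exists_mem_H hy hX
      refine ⟨x, ⟨hx, ?_⟩, ?_⟩
      · rw [one_mul, config_of]; exact hyx
      · rintro x' ⟨hx', h⟩
        rw [one_mul, config_of] at h
        exact S.eq_of_mem_H hX hx' hx h hyx
  | inr w =>
    refine ⟨fun e => ?_, fun e => ?_⟩
    · rw [one_mul, config_of_inv]
      constructor
      · intro h
        simpa using S.eq_of_mem_Ω h hy
      · rintro rfl; exact hy
    · rw [one_mul, Bool.eq_false_iff, Ne, config_of]
      intro h
      exact absurd (S.eq_of_mem_Ω (S.mem_Ω_of_mem_H h) hy) (by simp)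

theorem config_translate {y z : S.carrier} {g : FreeGroup E} (h : S.Move g y z) :
    S.config z = translate g⁻¹ (S.config y) := by
  funext k
  rw [translate, inv_inv, S.config_mul h]

theorem isConfiguration_config (y : S.carrier) : G.IsConfiguration (S.config y) where
  one_mem := by
    rw [config_eq_true]
    refine ⟨y, ?_⟩
    rw [Move, redWord_one]; rfl
  convex := by
    intro g h k hg hh hl
    obtain ⟨z, hz⟩ := S.config_eq_true.1 hg
    have h1 : S.config z (g⁻¹ * h) = true := by
      rw [← S.config_mul hz, mul_inv_cancel_left]; exact hh
    obtain ⟨u, hu⟩ := S.config_eq_true.1 h1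
    have h2 : g⁻¹ * k * (k⁻¹ * h) = g⁻¹ * h := by group
    have h3 := redWord_mul (g := g⁻¹ * k) (h := k⁻¹ * h) (by rw [h2]; exact hl)
    rw [h2] at h3
    rw [Move, h3, run_append] at hu
    obtain ⟨t, ht, -⟩ := hu
    have h4 : S.config z (g⁻¹ * k) = true := S.config_eq_true.2 ⟨t, ht⟩
    rw [← S.config_mul hz, mul_inv_cancel_left] at h4
    exact h4
  localType := by
    intro g hg
    obtain ⟨z, hz⟩ := S.config_eq_true.1 hg
    obtain ⟨v, hv⟩ := S.exists_mem_Ω z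
    refine ⟨v, ?_⟩
    have h := S.config_localType_one hv
    rw [S.config_translate hz, G.hasLocalType_translate] at h
    simpa using h

theorem isClopen_step (a : E × Bool) {W : Set S.carrier} (hW : IsClopen W) :
    IsClopen {y | ∃ z, S.Step a y z ∧ z ∈ W} := by
  obtain ⟨x, b⟩ := a
  cases b
  · have h : {y | ∃ z, S.Step (x, false) y z ∧ z ∈ W} =
        Subtype.val '' ((fun y => (S.θ x y : S.carrier)) ⁻¹' W) := by
      ext y
      constructor
      · rintro ⟨z, ⟨hy, rfl⟩, hz⟩
        exact ⟨⟨y, hy⟩, hz, rfl⟩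
      · rintro ⟨⟨y, hy⟩, hz, rfl⟩
        exact ⟨_, ⟨hy, rfl⟩, hz⟩
    rw [h]
    have hc := hW.preimage (f := fun y => (S.θ x y : S.carrier))
      (continuous_subtype_val.comp (S.θ x).continuous)
    exact ⟨(S.isClopen_Ω _).isClosed.isClosedEmbedding_subtypeVal.isClosedMap _ hc.isClosed,
      (S.isClopen_Ω _).isOpen.isOpenEmbedding_subtypeVal.isOpenMap _ hc.isOpen⟩
  · have h : {y | ∃ z, S.Step (x, true) y z ∧ z ∈ W} =
        Subtype.val '' ((fun y => ((S.θ x).symm y : S.carrier)) ⁻¹' W) := by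
      ext y
      constructor
      · rintro ⟨z, ⟨hz, rfl⟩, hw⟩
        exact ⟨S.θ x ⟨z, hz⟩, by simpa using hw, rfl⟩
      · rintro ⟨y, hz, rfl⟩
        exact ⟨_, ⟨((S.θ x).symm y).2, by simp⟩, hz⟩
    rw [h]
    have hc := hW.preimage (f := fun y => ((S.θ x).symm y : S.carrier))
      (continuous_subtype_val.comp (S.θ x).symm.continuous)
    exact ⟨(S.isClopen_H _).isClosed.isClosedEmbedding_subtypeVal.isClosedMap _ hc.isClosed,
      (S.isClopen_H _).isOpen.isOpenEmbedding_subtypeVal.isOpenMap _ hc.isOpen⟩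

theorem isClopen_run (L : List (E × Bool)) : IsClopen {y | ∃ z, S.Run L y z} := by
  induction L with
  | nil =>
    have h : {y : S.carrier | ∃ z, S.Run [] y z} = univ := by
      ext y; exact iff_of_true ⟨y, rfl⟩ trivial
    rw [h]; exact isClopen_univ
  | cons a L ih =>
    have h : {y : S.carrier | ∃ z, S.Run (a :: L) y z} =
        {y | ∃ u, S.Step a y u ∧ u ∈ {u | ∃ z, S.Run L u z}} := by
      ext y
      constructor
      · rintro ⟨z, u, h1, h2⟩; exact ⟨u, h1, z, h2⟩
      · rintro ⟨u, h1, z, h2⟩; exact ⟨z, u, h1, h2⟩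
    rw [h]; exact S.isClopen_step a ih

theorem continuous_config : Continuous S.config := by
  refine continuous_pi fun g => ?_
  refine continuous_bool_rng true |>.2 ?_
  have h : (fun y => S.config y g) ⁻¹' {true} = {y | ∃ z, S.Run (redWord g) y z} := by
    ext y; exact S.config_eq_true
  rw [h]; exact S.isClopen_run _

end DynamicalSystem

/-! ### `Ω(E, C)` is the universal `(E, C)`-dynamical system -/

section omega

universe w u₀ u₁ u₂

variable {V₀ : Type u₀} {V₁ : Type u₁} {E : Type u₂} (G : BipartiteSeparatedGraph V₀ V₁ E)

theorem isClopen_hasLocalType [Finite E] (g : FreeGroup E) (v : V₀ ⊕ V₁) :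
    IsClopen {ξ : FreeGroup E → Bool | G.HasLocalType ξ g v} := by
  let F : (FreeGroup E → Bool) → (E → Bool) × (E → Bool) := fun ξ =>
    (fun e => ξ (g * (FreeGroup.of e)⁻¹), fun e => ξ (g * FreeGroup.of e))
  have hF : Continuous F := by fun_prop
  cases v with
  | inl v => exact (isClopen_discrete {p : (E → Bool) × (E → Bool) | (∀ e, p.1 e = false) ∧
      (∀ e, p.2 e = true → G.r e = v) ∧
      ∀ X ∈ G.C v, ∃! e, e ∈ X ∧ p.2 e = true}).preimage hF
  | inr w => exact (isClopen_discrete {p : (E → Bool) × (E → Bool) |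
      (∀ e, p.1 e = true ↔ G.s e = w) ∧ ∀ e, p.2 e = false}).preimage hF

theorem isClosed_isConfiguration [Finite E] :
    IsClosed {ξ : FreeGroup E → Bool | G.IsConfiguration ξ} := by
  have : Finite V₀ := Finite.of_surjective _ G.r_surjective
  have : Finite V₁ := Finite.of_surjective _ G.s_surjective
  have ht : ∀ g, IsClopen {ξ : FreeGroup E → Bool | ξ g = true} := fun g =>
    (isClopen_discrete {true}).preimage (continuous_apply g)
  have h : {ξ : FreeGroup E → Bool | G.IsConfiguration ξ} =
      {ξ | ξ 1 = true} ∩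
      {ξ | ∀ g h k, ξ g = true → ξ h = true →
        wordLength (g⁻¹ * h) = wordLength (g⁻¹ * k) + wordLength (k⁻¹ * h) → ξ k = true} ∩
      {ξ | ∀ g, ξ g = true → ∃ v, G.HasLocalType ξ g v} := by
    ext ξ
    exact ⟨fun h => ⟨⟨h.1, h.2⟩, h.3⟩, fun h => ⟨h.1.1, h.1.2, h.2⟩⟩
  rw [h]
  refine ((ht 1).isClosed.inter ?_).inter ?_
  · simp only [Set.ofPred_forall]
    refine isClosed_iInter fun g => isClosed_iInter fun h => isClosed_iInter fun k => ?_
    refine isClosed_imp (ht g).isOpen (isClosed_imp (ht h).isOpen ?_)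
    by_cases hl : wordLength (g⁻¹ * h) = wordLength (g⁻¹ * k) + wordLength (k⁻¹ * h)
    · simpa [hl] using (ht k).isClosed
    · simp [hl]
  · simp only [Set.ofPred_forall]
    refine isClosed_iInter fun g => isClosed_imp (ht g).isOpen ?_
    simp only [Set.ofPred_exists]
    exact isClosed_iUnion_of_finite fun v => (G.isClopen_hasLocalType g v).isClosed

theorem compactSpace_omega [Finite E] : CompactSpace G.Omega :=
  isCompact_iff_compactSpace.1 G.isClosed_isConfiguration.isCompact

theorem HasLocalType.unique {ξ : FreeGroup E → Bool} {g : FreeGroup E} {v v' : V₀ ⊕ V₁}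
    (h : G.HasLocalType ξ g v) (h' : G.HasLocalType ξ g v') : v = v' := by
  cases v with
  | inl v =>
    cases v' with
    | inl v' =>
      obtain ⟨X, hX⟩ := G.exists_mem_C v
      obtain ⟨e, ⟨-, he⟩, -⟩ := h.2.2 X hX
      rw [← h.2.1 e he, ← h'.2.1 e he]
    | inr w' =>
      obtain ⟨e, rfl⟩ := G.s_surjective w'
      simpa [h.1 e] using (h'.1 e).2 rfl
  | inr w =>
    obtain ⟨e, rfl⟩ := G.s_surjective w
    have he := (h.1 e).2 rfl
    cases v' with
    | inl v' => simpa [h'.1 e] using he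
    | inr w' => rw [(h'.1 e).1 he]

theorem hasLocalType_of_mem_of {ξ : G.Omega} {x : E} (h : ξ.1 (FreeGroup.of x) = true) :
    G.HasLocalType ξ.1 1 (.inl (G.r x)) := by
  obtain ⟨v, hv⟩ := ξ.2.localType 1 ξ.2.one_mem
  cases v with
  | inl v =>
    have := hv.2.1 x (by rwa [one_mul])
    rwa [this]
  | inr w =>
    have h2 := hv.2 x
    rw [one_mul, h] at h2
    exact absurd h2 (by simp)

theorem hasLocalType_of_mem_of_inv {ξ : G.Omega} {x : E} :
    G.HasLocalType ξ.1 1 (.inr (G.s x)) ↔ ξ ∈ G.omegaSet (FreeGroup.of x)⁻¹ := by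
  constructor
  · intro h
    have := (h.1 x).2 rfl
    rwa [one_mul] at this
  · intro h
    obtain ⟨v, hv⟩ := ξ.2.localType 1 ξ.2.one_mem
    cases v with
    | inl v =>
      have h2 := hv.1 x
      rw [one_mul, G.mem_omegaSet.1 h] at h2
      exact absurd h2 (by simp)
    | inr w =>
      have := (hv.1 x).1 (by rw [one_mul]; exact h)
      rwa [this]

/-- The space `Ω(E, C)` as an `(E, C)`-dynamical system: `Ω_v` consists of the configurations of
local type `v` at `1`, `H_x = {ξ | x ∈ ξ}`, and `θ_x` is the homeomorphism given by the canonical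
partial action. -/
def omegaSystem [Finite E] : DynamicalSystem.{u₂} G where
  carrier := G.Omega
  compact := G.compactSpace_omega
  Ω v := {ξ | G.HasLocalType ξ.1 1 v}
  isClopen_Ω v := (G.isClopen_hasLocalType 1 v).preimage continuous_subtype_val
  disjoint_Ω v v' hne := Set.disjoint_left.2 fun _ h h' => hne (HasLocalType.unique G h h')
  iUnion_Ω := by
    ext ξ
    refine iff_of_true ?_ trivial
    obtain ⟨v, hv⟩ := ξ.2.localType 1 ξ.2.one_mem
    exact Set.mem_iUnion.2 ⟨v, hv⟩
  H x := G.omegaSet (FreeGroup.of x)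
  isClopen_H x := G.isClopen_omegaSet _
  disjoint_H := by
    intro v X hX x hx x' hx' hne
    refine Set.disjoint_left.2 fun ξ h h' => hne ?_
    have hv := G.hasLocalType_of_mem_of h
    rw [G.r_eq_of_mem hX hx] at hv
    exact (hv.2.2 X hX).unique ⟨hx, by rw [one_mul]; exact h⟩ ⟨hx', by rw [one_mul]; exact h'⟩
  biUnion_H := by
    intro v X hX
    ext ξ
    simp only [Set.mem_iUnion]
    constructor
    · rintro ⟨x, hx, h⟩
      have hv := G.hasLocalType_of_mem_of h
      rwa [G.r_eq_of_mem hX hx] at hv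
    · intro h
      obtain ⟨x, ⟨hx, h2⟩, -⟩ := h.2.2 X hX
      rw [one_mul] at h2
      exact ⟨x, hx, h2⟩
  θ x := (Homeomorph.setCongr (Set.ext fun _ => G.hasLocalType_of_mem_of_inv)).trans
    (G.canonicalPartialAction.θ (FreeGroup.of x))

theorem wordLength_mk_singleton (a : E × Bool) : wordLength (FreeGroup.mk [a]) = 1 := by
  rw [wordLength_eq, redWord_singleton]; rfl

theorem config_eq_of_equivariant [Finite E] (S : DynamicalSystem.{w} G)
    (f : S.carrier → G.Omega) (hf : DynamicalSystem.IsEquivariant S (omegaSystem G) f)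
    (y : S.carrier) : (f y).1 = S.config y := by
  have hΩ : ∀ y v, y ∈ S.Ω v ↔ G.HasLocalType (f y).1 1 v := by
    intro y v
    refine ⟨fun h => hf.map_Ω v h, fun h => ?_⟩
    obtain ⟨v', hv'⟩ := S.exists_mem_Ω y
    rwa [HasLocalType.unique G h (hf.map_Ω v' hv')]
  have hstep : ∀ a y z, S.Step a y z → (f z).1 = translate (FreeGroup.mk [a])⁻¹ (f y).1 := by
    rintro ⟨x, b⟩ y z h
    cases b
    · obtain ⟨hy, rfl⟩ := h
      rw [hf.map_θ x y hy]
      rfl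
    · obtain ⟨hz, rfl⟩ := h
      rw [hf.map_θ x z hz]
      change _ = translate (FreeGroup.of x)⁻¹ (translate (FreeGroup.of x) (f z).1)
      funext k
      simp [translate]
  have hdom : ∀ a y, (f y).1 (FreeGroup.mk [a]) = true → ∃ z, S.Step a y z := by
    rintro ⟨x, b⟩ y h
    cases b
    · rw [S.exists_step_false, hΩ]
      exact G.hasLocalType_of_mem_of_inv.2 h
    · rw [S.exists_step_true]
      have hv : G.HasLocalType (f y).1 1 (.inl (G.r x)) := G.hasLocalType_of_mem_of h
      obtain ⟨x', hx', hy'⟩ := S.exists_mem_H ((hΩ y _).2 hv) (G.part_mem x)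
      have h' : (f y).1 (FreeGroup.of x') = true := hf.map_H x' hy'
      have : x = x' := (hv.2.2 _ (G.part_mem x)).unique
        ⟨G.mem_part x, by rw [one_mul]; exact h⟩ ⟨hx', by rw [one_mul]; exact h'⟩
      rwa [this]
  have key : ∀ (L : List (E × Bool)), redWord (FreeGroup.mk L) = L → ∀ y,
      ((f y).1 (FreeGroup.mk L) = true ↔ ∃ z, S.Run L y z) := by
    intro L
    induction L with
    | nil =>
      intro _ y
      exact iff_of_true (f y).2.one_mem ⟨y, rfl⟩
    | cons a L ih =>
      intro hL y
      have hL' := redWord_cons hL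
      have hmul : FreeGroup.mk (a :: L) = FreeGroup.mk [a] * FreeGroup.mk L := by
        rw [FreeGroup.mul_mk]; rfl
      have htr : ∀ z, S.Step a y z →
          (f z).1 (FreeGroup.mk L) = (f y).1 (FreeGroup.mk (a :: L)) := by
        intro z hz
        rw [hstep a y z hz, hmul, translate, inv_inv]
      constructor
      · intro h
        have h1 : (f y).1 (FreeGroup.mk [a]) = true := by
          refine (f y).2.convex 1 (FreeGroup.mk (a :: L)) _ (f y).2.one_mem h ?_
          have h2 : (FreeGroup.mk [a])⁻¹ * FreeGroup.mk (a :: L) = FreeGroup.mk L := by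
            rw [hmul, inv_mul_cancel_left]
          rw [h2, inv_one, one_mul, one_mul, wordLength_mk_singleton, wordLength_eq,
            wordLength_eq, hL, hL', List.length_cons, add_comm]
        obtain ⟨z, hz⟩ := hdom a y h1
        obtain ⟨u, hu⟩ := (ih hL' z).1 (by rw [htr z hz]; exact h)
        exact ⟨u, z, hz, hu⟩
      · rintro ⟨u, z, hz, hu⟩
        rw [← htr z hz]
        exact (ih hL' z).2 ⟨u, hu⟩
  funext g
  rw [Bool.eq_iff_iff, S.config_eq_true]
  have := key (redWord g) (by rw [mk_redWord]) y
  rw [mk_redWord] at this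
  exact this

/-- `Ω(E, C)` is the universal `(E, C)`-dynamical system. -/
theorem isUniversal_omegaSystem [Finite E] :
    DynamicalSystem.IsUniversal.{w} (omegaSystem G) := by
  intro S
  refine ⟨fun y => ⟨S.config y, S.isConfiguration_config y⟩, ⟨?_, ?_⟩, ?_⟩
  · exact Continuous.subtype_mk S.continuous_config _
  · refine ⟨fun v y hy => S.config_localType_one hy, fun x y hy => S.config_of.2 hy, ?_⟩
    intro x y hy
    apply Omega.ext
    intro k
    have hm : S.Move (FreeGroup.of x)⁻¹ y (S.θ x ⟨y, hy⟩) := S.move_of_inv.2 ⟨hy, rfl⟩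
    change S.config (S.θ x ⟨y, hy⟩) k = translate (FreeGroup.of x) (S.config y) k
    rw [S.config_translate hm, inv_inv]
  · rintro f ⟨-, hf⟩
    funext y
    exact Subtype.ext (G.config_eq_of_equivariant S f hf y)

/-- The canonical partial action is semi-saturated: if `|g h| = |g| + |h|`, then
`U_{g h} ⊆ U_g`. So `θ_g` is the composition of the maps `θ_x^{±1}` along the reduced word
of `g`. -/
theorem omegaSet_mul_subset {g h : FreeGroup E}
    (hl : wordLength (g * h) = wordLength g + wordLength h) :
    G.canonicalPartialAction.U (g * h) ⊆ G.canonicalPartialAction.U g := by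
  intro ξ hξ
  exact ξ.2.convex 1 (g * h) g ξ.2.one_mem hξ (by simpa using hl)

end omega

end BipartiteSeparatedGraph

/-! A configuration is a subtree of the Cayley tree of the free group. At a point of type in
`E^{0,1}` its neighbours are forced; at a point of type `v` in `E^{0,0}` it freely picks one edge
from each set of `C v`, apart from the set through which the point was reached from `1`. So freedom
exists exactly where such a set has at least two elements, and an entry is a path leading to such a
place.

If a cycle has no entry, no choice is ever available beyond its base vertex `w`. There is then
exactly one configuration of type `w` at `1`, and it forms an open set. Travelling round the cycle
leads again to a point of type `w`, so the corresponding nontrivial group element fixes this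
isolated configuration (`conditionL_of_isTopologicallyFree`).

Conversely, let `ξ` be interior to the fixed points of `t ≠ 1`. After moving the base point within
`ξ`, `t` is of minimal length among its conjugates by elements of `ξ`, hence cyclically reduced, and
`1` has type in `E^{0,1}`. All powers of `t` lie in `ξ`, and a large power spells a long admissible
path. By the pigeonhole principle and (L), an entry starts at some point `g` of this path
(`ConditionL.exists_isEntry`); following it gives a choice in `ξ` at some `g y`
(`IsConfiguration.exists_choice`). By invariance the choice recurs at the translates of `g y` by
powers of `t`, and in at least one of the two directions along the axis these run off to infinity
without cancellation. Changing the choice far out gives a configuration that agrees with `ξ` on a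
large ball (`IsConfiguration.exists_modification`). It is not fixed by `t`, because one translate
closer to `1` the old choice is still visible (`IsConfiguration.exists_not_fixed`). This contradicts
interiority. -/

namespace BipartiteSeparatedGraph

/-! ### Reduced words and geodesics in the free group -/

section words

variable {E : Type*}

theorem isReduced_redWord (g : FreeGroup E) : FreeGroup.IsReduced (redWord g) := by
  let _ := Classical.decEq E
  exact FreeGroup.isReduced_toWord

theorem redWord_mk {L : List (E × Bool)} (h : FreeGroup.IsReduced L) :
    redWord (FreeGroup.mk L) = L := by
  let _ := Classical.decEq E
  exact h.reduce_eq

theorem redWord_injective : Function.Injective (redWord : FreeGroup E → List (E × Bool)) := by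
  intro g h hgh
  rw [← mk_redWord g, hgh, mk_redWord]

theorem wordLength_mk_le (L : List (E × Bool)) : wordLength (FreeGroup.mk L) ≤ L.length :=
  (red_redWord L).length_le

theorem wordLength_mul_le (g h : FreeGroup E) :
    wordLength (g * h) ≤ wordLength g + wordLength h := by
  let _ := Classical.decEq E
  exact FreeGroup.norm_mul_le g h

theorem wordLength_inv (g : FreeGroup E) : wordLength g⁻¹ = wordLength g := by
  let _ := Classical.decEq E
  exact FreeGroup.norm_inv_eq

theorem wordLength_one : wordLength (1 : FreeGroup E) = 0 := by
  let _ := Classical.decEq E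
  exact FreeGroup.norm_one

theorem wordLength_eq_zero {g : FreeGroup E} : wordLength g = 0 ↔ g = 1 := by
  let _ := Classical.decEq E
  exact FreeGroup.norm_eq_zero

theorem isReduced_append_iff {L L' : List (E × Bool)} :
    FreeGroup.IsReduced (L ++ L') ↔ FreeGroup.IsReduced L ∧ FreeGroup.IsReduced L' ∧
      ∀ x ∈ L.getLast?, ∀ y ∈ L'.head?, x.1 = y.1 → x.2 = y.2 :=
  List.isChain_append

theorem redWord_mul_of_isReduced {g h : FreeGroup E}
    (hr : FreeGroup.IsReduced (redWord g ++ redWord h)) :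
    redWord (g * h) = redWord g ++ redWord h := by
  rw [← redWord_mk hr, ← FreeGroup.mul_mk, mk_redWord, mk_redWord]

/-- If there is cancellation in the product `g h`, then the reduced word of `g` ends in the inverse
of the first letter of `h`. -/
theorem exists_cancel {g h : FreeGroup E} (hl : wordLength (g * h) ≠ wordLength g + wordLength h) :
    ∃ y L, (redWord h).head? = some y ∧ redWord g = L ++ [(y.1, !y.2)] := by
  by_contra hc
  refine hl ?_
  rw [wordLength_eq, redWord_mul_of_isReduced, List.length_append]; rfl
  refine isReduced_append_iff.2 ⟨isReduced_redWord _, isReduced_redWord _, ?_⟩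
  intro x hx y hy hxy
  by_contra hne
  refine hc ⟨y, (redWord g).dropLast, hy, ?_⟩
  have h1 : x = (y.1, !y.2) := Prod.ext hxy (by cases h : x.2 <;> cases h' : y.2 <;> simp_all)
  rw [← h1]
  exact (List.dropLast_append_getLast? x hx).symm

/-- If two elements both cancel against `h`, then they cancel against each other. -/
theorem wordLength_mul_inv_lt {g g' h : FreeGroup E}
    (hl : wordLength (g * h) ≠ wordLength g + wordLength h)
    (hl' : wordLength (g' * h) ≠ wordLength g' + wordLength h) :
    wordLength (g * g'⁻¹) < wordLength g + wordLength g' := by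
  obtain ⟨y, L, hy, hL⟩ := exists_cancel hl
  obtain ⟨y', L', hy', hL'⟩ := exists_cancel hl'
  obtain rfl : y = y' := by rw [hy] at hy'; simpa using hy'
  have h1 : g * g'⁻¹ = FreeGroup.mk L * (FreeGroup.mk L')⁻¹ := by
    rw [← mk_redWord g, ← mk_redWord g', hL, hL', ← FreeGroup.mul_mk, ← FreeGroup.mul_mk]
    group
  rw [h1]
  have h2 := wordLength_mul_le (FreeGroup.mk L) (FreeGroup.mk L')⁻¹
  rw [wordLength_inv] at h2
  have h3 := wordLength_mk_le L
  have h4 := wordLength_mk_le L'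
  rw [wordLength_eq g, wordLength_eq g', hL, hL']
  simp only [List.length_append, List.length_singleton]
  omega

/-- A neighbour in the Cayley tree is one step further from `1` or one step back. -/
theorem redWord_mul_letter (g : FreeGroup E) (a : E × Bool) :
    redWord (g * FreeGroup.mk [a]) = redWord g ++ [a] ∨
      redWord g = redWord (g * FreeGroup.mk [a]) ++ [(a.1, !a.2)] := by
  by_cases hl : wordLength (g * FreeGroup.mk [a]) = wordLength g + wordLength (FreeGroup.mk [a])
  · left
    rw [redWord_mul hl, redWord_singleton]
  · right
    obtain ⟨y, L, hy, hL⟩ := exists_cancel hl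
    obtain rfl : a = y := by rw [redWord_singleton] at hy; simpa using hy
    have h1 : FreeGroup.IsReduced L :=
      (isReduced_append_iff.1 (hL ▸ isReduced_redWord g)).1
    have h2 : g * FreeGroup.mk [a] = FreeGroup.mk L := by
      have : FreeGroup.mk [(a.1, !a.2)] = (FreeGroup.mk [a])⁻¹ := rfl
      rw [← mk_redWord g, hL, ← FreeGroup.mul_mk, this, inv_mul_cancel_right]
    rw [h2, redWord_mk h1, hL]

theorem wordLength_mul_letter_iff {g : FreeGroup E} {a : E × Bool} :
    wordLength (g * FreeGroup.mk [a]) = wordLength g + 1 ↔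
      redWord (g * FreeGroup.mk [a]) = redWord g ++ [a] := by
  rcases redWord_mul_letter g a with h | h
  · simp [wordLength_eq, h]
  · have h1 := congrArg List.length h
    rw [List.length_append, List.length_singleton] at h1
    rw [wordLength_eq, wordLength_eq]
    refine iff_of_false (by omega) fun h2 => ?_
    have h3 := congrArg List.length h2
    rw [List.length_append, List.length_singleton] at h3
    omega

theorem prefix_or_of_prefix_append {α : Type*} {P A B : List α} (h : P <+: A ++ B) :
    P <+: A ∨ ∃ Q, P = A ++ Q ∧ Q <+: B := by
  obtain ⟨R, hR⟩ := h
  rcases List.append_eq_append_iff.1 hR with ⟨as, h1, -⟩ | ⟨bs, h1, h2⟩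
  · exact Or.inl ⟨as, h1.symm⟩
  · exact Or.inr ⟨bs, h1, R, h2.symm⟩

/-- The geodesic visits only vertices already visited by the unreduced path. For one cancellation, a
prefix reaching beyond the deleted pair is lifted by putting the pair back. -/
theorem exists_prefix_of_red {L L' : List (E × Bool)} (h : FreeGroup.Red L L')
    {P' : List (E × Bool)} (hP : P' <+: L') :
    ∃ P, P <+: L ∧ FreeGroup.mk P = FreeGroup.mk P' := by
  induction h generalizing P' with
  | refl => exact ⟨P', hP, rfl⟩
  | tail _ hs ih =>
    cases hs with
    | @not L₁ L₂ x b =>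
      rcases prefix_or_of_prefix_append hP with h1 | ⟨Q, rfl, h2⟩
      · exact ih (h1.trans (List.prefix_append _ _))
      · obtain ⟨P, h3, h4⟩ := ih (P' := L₁ ++ (x, b) :: (x, !b) :: Q)
          ((List.prefix_append_right_inj _).2
            ((List.prefix_cons_inj _).2 ((List.prefix_cons_inj _).2 h2)))
        refine ⟨P, h3, h4.trans ?_⟩
        exact Quot.sound FreeGroup.Red.Step.not

/-- A point on the geodesic from `g` to `h` lies on the geodesic from `1` to `g` or on the geodesic
from `1` to `h`. -/
theorem prefix_of_geodesic {g h k : FreeGroup E}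
    (hl : wordLength (g⁻¹ * h) = wordLength (g⁻¹ * k) + wordLength (k⁻¹ * h)) :
    redWord k <+: redWord g ∨ redWord k <+: redWord h := by
  have h2 : g⁻¹ * k * (k⁻¹ * h) = g⁻¹ * h := by group
  have h3 := redWord_mul (g := g⁻¹ * k) (h := k⁻¹ * h) (by rw [h2]; exact hl)
  rw [h2] at h3
  have hred : FreeGroup.Red (FreeGroup.invRev (redWord g) ++ redWord h) (redWord (g⁻¹ * h)) := by
    have := red_redWord (FreeGroup.invRev (redWord g) ++ redWord h)
    rwa [← FreeGroup.mul_mk, ← FreeGroup.inv_mk, mk_redWord, mk_redWord] at this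
  obtain ⟨P, hP, hP'⟩ := exists_prefix_of_red hred
    (P' := redWord (g⁻¹ * k)) (by rw [h3]; exact List.prefix_append _ _)
  rw [mk_redWord] at hP'
  -- The unreduced path runs from `g` back to `1` and then out to `h`; the two cases say on which
  -- leg `k` is met.
  rcases prefix_or_of_prefix_append hP with ⟨Q, hQ⟩ | ⟨Q, rfl, hQ⟩
  · left
    have h4 : redWord g = FreeGroup.invRev Q ++ FreeGroup.invRev P := by
      rw [← FreeGroup.invRev_append, hQ, FreeGroup.invRev_invRev]
    have h5 : k = FreeGroup.mk (FreeGroup.invRev Q) := by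
      have : k = g * FreeGroup.mk P := by rw [hP']; group
      rw [this]
      conv_lhs => rw [← mk_redWord g, h4]
      rw [← FreeGroup.mul_mk, ← FreeGroup.inv_mk (L := P), inv_mul_cancel_right]
    rw [h5, redWord_mk, h4]
    · exact List.prefix_append _ _
    · exact (isReduced_append_iff.1 (h4 ▸ isReduced_redWord g)).1
  · right
    have h5 : k = FreeGroup.mk Q := by
      have : k = g * (g⁻¹ * k) := by group
      rw [this, ← hP', ← FreeGroup.mul_mk, ← redWord_inv, mk_redWord]
      group
    rw [h5, redWord_mk]
    · exact hQ
    · exact (isReduced_redWord h).infix hQ.isInfix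

/-- Convexity applied to the geodesic from `1`. By `prefix_of_geodesic`, closure under prefixes also
gives convexity back, which is how configurations are built below. -/
theorem IsConfiguration.of_prefix {V₀ V₁ : Type*} {G : BipartiteSeparatedGraph V₀ V₁ E}
    {ξ : FreeGroup E → Bool} (hξ : G.IsConfiguration ξ) {L L' : List (E × Bool)}
    (hL : FreeGroup.IsReduced L) (hL' : L' <+: L) (h : ξ (FreeGroup.mk L) = true) :
    ξ (FreeGroup.mk L') = true := by
  obtain ⟨Q, rfl⟩ := hL'
  refine hξ.convex 1 _ _ hξ.one_mem h ?_
  rw [inv_one, one_mul, one_mul, ← FreeGroup.mul_mk, inv_mul_cancel_left, FreeGroup.mul_mk]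
  rw [wordLength_eq, wordLength_eq, wordLength_eq, redWord_mk hL,
    redWord_mk (isReduced_append_iff.1 hL).1, redWord_mk (isReduced_append_iff.1 hL).2.1,
    List.length_append]

end words
-- Configurations built from choice functions
section construction

variable {V₀ V₁ E : Type*} (G : BipartiteSeparatedGraph V₀ V₁ E)

theorem eq_part_of_mem {v : V₀} {X : Set E} (hX : X ∈ G.C v) {e : E} (he : e ∈ X) :
    X = G.part e := by
  by_contra hne
  have hr := G.r_eq_of_mem hX he
  have h1 := G.part_mem e
  rw [hr] at h1
  exact Set.disjoint_left.1 (G.pairwiseDisjoint_C v hX h1 hne) he (G.mem_part e)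

/-- The type of the end point of a path with given reversed word, starting at a point of
type `τ`. -/
def endType (τ : V₀ ⊕ V₁) : List (E × Bool) → V₀ ⊕ V₁
  | [] => τ
  | (e, true) :: _ => .inr (G.s e)
  | (e, false) :: _ => .inl (G.r e)

/-- The reversed words that belong to the configuration of type `τ` given by the choices `c`. -/
def IsValid (τ : V₀ ⊕ V₁) (c : List (E × Bool) → Set E → E) : List (E × Bool) → Prop
  | [] => True
  | (e, false) :: M => IsValid τ c M ∧ G.endType τ M = .inr (G.s e)
  | (e, true) :: M => IsValid τ c M ∧ G.endType τ M = .inl (G.r e) ∧ e = c M (G.part e) ∧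
      ∀ f, M.head? = some (f, false) → G.part f ≠ G.part e

open scoped Classical in
/-- The configuration of type `τ` at `1` that is given by the choices `c`. -/
noncomputable def choiceConfig (τ : V₀ ⊕ V₁) (c : List (E × Bool) → Set E → E) :
    FreeGroup E → Bool :=
  fun g => decide (G.IsValid τ c (redWord g).reverse)

variable {G} {τ : V₀ ⊕ V₁} {c : List (E × Bool) → Set E → E}

theorem choiceConfig_eq_true {g : FreeGroup E} :
    G.choiceConfig τ c g = true ↔ G.IsValid τ c (redWord g).reverse := by
  simp [choiceConfig]

theorem IsValid.of_suffix {M M' : List (E × Bool)} (h : G.IsValid τ c M) (hs : M' <:+ M) :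
    G.IsValid τ c M' := by
  induction M with
  | nil => rwa [List.suffix_nil.1 hs]
  | cons a M ih =>
    rcases List.suffix_cons_iff.1 hs with rfl | h1
    · exact h
    · refine ih ?_ h1
      obtain ⟨e, b⟩ := a
      cases b <;> exact h.1

theorem reverse_redWord_mul_letter (g : FreeGroup E) (a : E × Bool) :
    (redWord (g * FreeGroup.mk [a])).reverse = a :: (redWord g).reverse ∨
      (redWord g).reverse = (a.1, !a.2) :: (redWord (g * FreeGroup.mk [a])).reverse := by
  rcases redWord_mul_letter g a with h | h
  · left; rw [h]; simp
  · right; rw [h]; simp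

/-- The type of a point is dictated by the last letter of its word, and validity admits exactly the
outgoing letters that this type requires; the step back supplies the one remaining neighbour. -/
theorem hasLocalType_choiceConfig (hc : ∀ v, ∀ X ∈ G.C v, ∀ M, c M X ∈ X) {g : FreeGroup E}
    (hg : G.choiceConfig τ c g = true) :
    G.HasLocalType (G.choiceConfig τ c) g (G.endType τ (redWord g).reverse) := by
  rw [choiceConfig_eq_true] at hg
  -- A neighbour in the configuration is either the predecessor of `g`, or a valid extension that
  -- does not cancel.
  have key : ∀ e b, G.choiceConfig τ c (g * FreeGroup.mk [(e, b)]) = true ↔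
      (redWord g).reverse.head? = some (e, !b) ∨
        G.IsValid τ c ((e, b) :: (redWord g).reverse) ∧
          (redWord g).reverse.head? ≠ some (e, !b) := by
    intro e b
    rw [choiceConfig_eq_true]
    rcases reverse_redWord_mul_letter g (e, b) with h | h
    · rw [h]
      by_cases h1 : (redWord g).reverse.head? = some (e, !b)
      · exfalso
        have h2 := isReduced_redWord (g * FreeGroup.mk [(e, b)])
        obtain ⟨M, hM⟩ : ∃ M, (redWord g).reverse = (e, !b) :: M := by
          cases hr : (redWord g).reverse with
          | nil => simp [hr] at h1
          | cons a M => rw [hr] at h1; exact ⟨M, by simpa using h1⟩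
        rw [hM] at h
        have h3 : redWord (g * FreeGroup.mk [(e, b)]) = M.reverse ++ [(e, !b), (e, b)] := by
          rw [← List.reverse_reverse (redWord _), h]; simp
        rw [h3] at h2
        have := (isReduced_append_iff.1 h2).2.1
        simp at this
      · exact ⟨fun h2 => Or.inr ⟨h2, h1⟩, fun h2 => h2.elim (fun h3 => absurd h3 h1) And.left⟩
    · have h1 : (redWord g).reverse.head? = some (e, !b) := by rw [h]; rfl
      refine iff_of_true (hg.of_suffix ?_) (Or.inl h1)
      rw [h]; exact List.suffix_cons _ _
  have hof : ∀ e : E, FreeGroup.of e = FreeGroup.mk [(e, true)] := fun _ => rfl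
  have hinv : ∀ e : E, (FreeGroup.of e)⁻¹ = FreeGroup.mk [(e, false)] := fun _ => rfl
  have hhead : ∀ e b, (redWord g).reverse.head? = some (e, b) →
      G.endType τ (redWord g).reverse = G.endType τ [(e, b)] := by
    intro e b h
    cases hr : (redWord g).reverse with
    | nil => simp [hr] at h
    | cons a M =>
      rw [hr] at h
      obtain rfl : a = (e, b) := by simpa using h
      cases b <;> rfl
  cases hT : G.endType τ (redWord g).reverse with
  | inr w =>
    refine ⟨fun e => ?_, fun e => ?_⟩
    · rw [hinv, key]
      constructor
      · rintro (h | ⟨⟨-, h⟩, -⟩)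
        · have := hhead _ _ h
          rw [hT] at this
          simpa [endType] using this.symm
        · rw [hT] at h; simpa using h.symm
      · rintro rfl
        by_cases h : (redWord g).reverse.head? = some (e, true)
        · exact Or.inl h
        · exact Or.inr ⟨⟨hg, hT⟩, h⟩
    · rw [hof, Bool.eq_false_iff, Ne, key]
      rintro (h | ⟨⟨-, h, -⟩, -⟩)
      · have := hhead _ _ h
        rw [hT] at this
        simp [endType] at this
      · rw [hT] at h; simp at h
  | inl v =>
    have hr : ∀ e, G.choiceConfig τ c (g * FreeGroup.of e) = true → G.r e = v := by
      intro e
      rw [hof, key]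
      rintro (h | ⟨⟨-, h, -⟩, -⟩)
      · have := hhead _ _ h
        rw [hT] at this
        simpa [endType] using this.symm
      · rw [hT] at h; simpa using h.symm
    refine ⟨fun e => ?_, hr, fun X hX => ?_⟩
    · rw [hinv, Bool.eq_false_iff, Ne, key]
      rintro (h | ⟨⟨-, h⟩, -⟩)
      · have := hhead _ _ h
        rw [hT] at this
        simp [endType] at this
      · rw [hT] at h; simp at h
    -- If `g` was reached by `f⁻¹` with `f ∈ X`, then going back along `f` is already the edge for
    -- `X`, and the last clause of `IsValid` forbids a second one. Otherwise the edge is the chosen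
    -- one.
    · by_cases hf : ∃ f ∈ X, (redWord g).reverse.head? = some (f, false)
      · obtain ⟨f, hfX, hf⟩ := hf
        refine ⟨f, ⟨hfX, ?_⟩, ?_⟩
        · rw [hof, key]; exact Or.inl hf
        · rintro e ⟨heX, he⟩
          rw [hof, key] at he
          rcases he with h | ⟨⟨-, -, -, h⟩, -⟩
          · rw [hf] at h; simpa using h.symm
          · exact absurd ((G.eq_part_of_mem hX hfX).symm.trans (G.eq_part_of_mem hX heX)) (h f hf)
      · have hcX := hc v X hX (redWord g).reverse
        refine ⟨c (redWord g).reverse X, ⟨hcX, ?_⟩, ?_⟩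
        · rw [hof, key]
          refine Or.inr ⟨⟨hg, ?_, ?_, ?_⟩, ?_⟩
          · rw [hT, G.r_eq_of_mem hX hcX]
          · rw [← G.eq_part_of_mem hX hcX]
          · intro f h1 h2
            rw [← G.eq_part_of_mem hX hcX] at h2
            exact hf ⟨f, h2 ▸ G.mem_part f, h1⟩
          · exact fun h => hf ⟨_, hcX, h⟩
        · rintro e ⟨heX, he⟩
          rw [hof, key] at he
          rcases he with h | ⟨⟨-, -, h, -⟩, -⟩
          · exact absurd ⟨e, heX, h⟩ hf
          · rw [h, ← G.eq_part_of_mem hX heX]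

theorem isConfiguration_choiceConfig (hc : ∀ v, ∀ X ∈ G.C v, ∀ M, c M X ∈ X) :
    G.IsConfiguration (G.choiceConfig τ c) where
  one_mem := by
    rw [choiceConfig_eq_true, redWord_one]; trivial
  convex := by
    intro g h k hg hh hl
    rw [choiceConfig_eq_true] at *
    rcases prefix_of_geodesic hl with h1 | h1
    · exact hg.of_suffix (List.reverse_suffix.2 h1)
    · exact hh.of_suffix (List.reverse_suffix.2 h1)
  localType g hg := ⟨_, hasLocalType_choiceConfig hc hg⟩

theorem nonempty_of_mem_C {v : V₀} {X : Set E} (hX : X ∈ G.C v) : X.Nonempty := by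
  rw [Set.nonempty_iff_ne_empty]
  rintro rfl
  exact G.empty_notMem v hX

/-- Every vertex is the type at `1` of some configuration. -/
theorem exists_hasLocalType_one [Nonempty E] (τ : V₀ ⊕ V₁) :
    ∃ ξ : G.Omega, G.HasLocalType ξ.1 1 τ := by
  classical
  have h : ∀ X : Set E, ∃ e, X.Nonempty → e ∈ X := by
    intro X
    by_cases hX : X.Nonempty
    · exact ⟨hX.some, fun _ => hX.some_mem⟩
    · exact ⟨Classical.arbitrary E, fun h => absurd h hX⟩
  choose c hc using h
  have hc' : ∀ v, ∀ X ∈ G.C v, ∀ M : List (E × Bool), (fun _ X => c X) M X ∈ X :=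
    fun v X hX _ => hc X (nonempty_of_mem_C hX)
  refine ⟨⟨_, isConfiguration_choiceConfig (τ := τ) hc'⟩, ?_⟩
  have h1 := hasLocalType_choiceConfig (τ := τ) hc'
    (isConfiguration_choiceConfig (τ := τ) hc').one_mem
  rwa [redWord_one] at h1

end construction
-- Changing a configuration at a single choice
section modification

variable {V₀ V₁ E : Type*} {G : BipartiteSeparatedGraph V₀ V₁ E} {ξ : FreeGroup E → Bool}

theorem IsConfiguration.hasLocalType_inl (hξ : G.IsConfiguration ξ) {g : FreeGroup E} {e : E}
    (hg : ξ g = true) (h : ξ (g * FreeGroup.of e) = true) : G.HasLocalType ξ g (.inl (G.r e)) := by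
  obtain ⟨v, hv⟩ := hξ.localType g hg
  cases v with
  | inl v => rwa [hv.2.1 e h]
  | inr w => simp [hv.2 e] at h

theorem IsConfiguration.hasLocalType_inr (hξ : G.IsConfiguration ξ) {g : FreeGroup E} {e : E}
    (hg : ξ g = true) (h : ξ (g * (FreeGroup.of e)⁻¹) = true) :
    G.HasLocalType ξ g (.inr (G.s e)) := by
  obtain ⟨v, hv⟩ := hξ.localType g hg
  cases v with
  | inl v => simp [hv.1 e] at h
  | inr w => rwa [(hv.1 e).1 h]

theorem IsConfiguration.hasLocalType_mul_inv (hξ : G.IsConfiguration ξ) {g : FreeGroup E} {e : E}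
    (hg : ξ g = true) (h : ξ (g * (FreeGroup.of e)⁻¹) = true) :
    G.HasLocalType ξ (g * (FreeGroup.of e)⁻¹) (.inl (G.r e)) :=
  hξ.hasLocalType_inl h (by rwa [inv_mul_cancel_right])

theorem IsConfiguration.hasLocalType_mul_of (hξ : G.IsConfiguration ξ) {g : FreeGroup E} {e : E}
    (hg : ξ g = true) (h : ξ (g * FreeGroup.of e) = true) :
    G.HasLocalType ξ (g * FreeGroup.of e) (.inr (G.s e)) :=
  hξ.hasLocalType_inr h (by rwa [mul_inv_cancel_right])

/-- The edges of a configuration that lie in the same set of the partition are equal. -/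
theorem IsConfiguration.eq_of_part_eq (hξ : G.IsConfiguration ξ) {g : FreeGroup E} {e e' : E}
    (hg : ξ g = true) (h : ξ (g * FreeGroup.of e) = true) (h' : ξ (g * FreeGroup.of e') = true)
    (hp : G.part e = G.part e') : e = e' :=
  ((hξ.hasLocalType_inl hg h).2.2 _ (G.part_mem e)).unique ⟨G.mem_part e, h⟩
    ⟨hp ▸ G.mem_part e', h'⟩

theorem IsConfiguration.of_mul (hξ : G.IsConfiguration ξ) {g h : FreeGroup E}
    (hl : wordLength (g * h) = wordLength g + wordLength h) (hgh : ξ (g * h) = true) :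
    ξ g = true :=
  hξ.convex 1 (g * h) g hξ.one_mem hgh (by simpa using hl)

/-- The edge leading back towards `1` determines the type. This matches an arbitrary configuration
with the recursive description by `IsValid`. -/
theorem IsConfiguration.hasLocalType_endType (hξ : G.IsConfiguration ξ) {τ : V₀ ⊕ V₁}
    (hτ : G.HasLocalType ξ 1 τ) {M : List (E × Bool)} (hM : FreeGroup.IsReduced M.reverse)
    (h : ξ (FreeGroup.mk M.reverse) = true) :
    G.HasLocalType ξ (FreeGroup.mk M.reverse) (G.endType τ M) := by
  cases M with
  | nil => exact hτ
  | cons a M =>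
    rw [List.reverse_cons] at hM h ⊢
    have h1 := hξ.of_prefix hM (List.prefix_append _ _) h
    rw [← FreeGroup.mul_mk] at h ⊢
    obtain ⟨e, b⟩ := a
    cases b
    · exact hξ.hasLocalType_mul_inv h1 h
    · exact hξ.hasLocalType_mul_of h1 h

/-- A configuration may be modified beyond a point `h` where it goes through an edge `e` that lies
in a set `X ∈ C_v` with at least two elements. -/
theorem IsConfiguration.exists_modification (hξ : G.IsConfiguration ξ) {h : FreeGroup E} {v : V₀}
    {X : Set E} {e e' : E} (hX : X ∈ G.C v) (he : e ∈ X) (he' : e' ∈ X) (hne : e ≠ e')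
    (hhe : ξ (h * FreeGroup.of e) = true)
    (hl : wordLength (h * FreeGroup.of e) = wordLength h + 1) :
    ∃ η, G.IsConfiguration η ∧ η (h * FreeGroup.of e') = true ∧
      ξ (h * FreeGroup.of e') = false ∧
      ∀ g, wordLength g ≤ wordLength h + 1 → g ≠ h * FreeGroup.of e → g ≠ h * FreeGroup.of e' →
        η g = ξ g := by
  classical
  have hof : ∀ e : E, FreeGroup.of e = FreeGroup.mk [(e, true)] := fun _ => rfl
  have hrw : redWord (h * FreeGroup.of e) = redWord h ++ [(e, true)] :=
    wordLength_mul_letter_iff.1 hl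
  have hh : ξ h = true := hξ.of_mul (by rw [hl, hof, wordLength_mk_singleton]) hhe
  have hpe := G.eq_part_of_mem hX he
  have hpe' := G.eq_part_of_mem hX he'
  have hξe' : ξ (h * FreeGroup.of e') = false := by
    rw [Bool.eq_false_iff]
    exact fun h1 => hne (hξ.eq_of_part_eq hh hhe h1 (hpe.symm.trans hpe'))
  -- The edge for `X` at `h` is a free choice: had `h` been reached by `f⁻¹` with `f ∈ X`,
  -- uniqueness in `X` would give `e = f`, and `h e` would be a step back.
  have hhead : ∀ f ∈ X, (redWord h).reverse.head? ≠ some (f, false) := by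
    intro f hf hhd
    obtain ⟨M, hM⟩ : ∃ M, (redWord h).reverse = (f, false) :: M := by
      cases hr : (redWord h).reverse with
      | nil => simp [hr] at hhd
      | cons a M => rw [hr] at hhd; exact ⟨M, by simpa using hhd⟩
    have hM' : redWord h = M.reverse ++ [(f, false)] := by
      rw [← List.reverse_reverse (redWord h), hM, List.reverse_cons]
    have h1 : h * FreeGroup.of f = FreeGroup.mk M.reverse := by
      conv_lhs => rw [← mk_redWord h, hM', ← FreeGroup.mul_mk]
      rw [show FreeGroup.mk [(f, false)] = (FreeGroup.of f)⁻¹ from rfl, inv_mul_cancel_right]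
    have h2 : ξ (h * FreeGroup.of f) = true := by
      rw [h1]
      refine hξ.of_prefix (isReduced_redWord h) ?_ (by rwa [mk_redWord])
      rw [hM']; exact List.prefix_append _ _
    obtain rfl : e = f :=
      hξ.eq_of_part_eq hh hhe h2 (hpe.symm.trans (G.eq_part_of_mem hX hf))
    have h3 := isReduced_redWord (h * FreeGroup.of e)
    rw [hrw, hM', List.append_assoc] at h3
    have := (isReduced_append_iff.1 h3).2.1
    simp at this
  have hrw' : redWord (h * FreeGroup.of e') = redWord h ++ [(e', true)] := by
    rcases redWord_mul_letter h (e', true) with h1 | h1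
    · exact h1
    · exact absurd (by rw [h1]; simp) (hhead e' he')
  obtain ⟨τ, hτ⟩ := hξ.localType 1 hξ.one_mem
  -- The choice function copies `ξ` wherever `ξ` has an edge in `Y`, except at `h` and `X`, where it
  -- takes `e'`. Off `ξ` it is any element of `Y`.
  have hex : ∀ (M : List (E × Bool)) (Y : Set E), ∃ x,
      (M = (redWord h).reverse ∧ Y = X → x = e') ∧
      (¬ (M = (redWord h).reverse ∧ Y = X) →
        (Y.Nonempty → x ∈ Y) ∧
        ∀ y ∈ Y, ξ (FreeGroup.mk M.reverse * FreeGroup.of y) = true →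
          ξ (FreeGroup.mk M.reverse * FreeGroup.of x) = true) := by
    intro M Y
    by_cases h1 : M = (redWord h).reverse ∧ Y = X
    · exact ⟨e', fun _ => rfl, fun h2 => absurd h1 h2⟩
    · by_cases h2 : ∃ y ∈ Y, ξ (FreeGroup.mk M.reverse * FreeGroup.of y) = true
      · obtain ⟨y, hy, hy'⟩ := h2
        exact ⟨y, fun h3 => absurd h3 h1, fun _ => ⟨fun _ => hy, fun _ _ _ => hy'⟩⟩
      · by_cases h3 : Y.Nonempty
        · exact ⟨h3.some, fun h3 => absurd h3 h1, fun _ => ⟨fun _ => h3.some_mem,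
            fun y hy hy' => absurd ⟨y, hy, hy'⟩ h2⟩⟩
        · exact ⟨e, fun h3 => absurd h3 h1, fun _ => ⟨fun h4 => absurd h4 h3,
            fun y hy hy' => absurd ⟨y, hy, hy'⟩ h2⟩⟩
  choose c hc1 hc2 using hex
  have hc : ∀ v, ∀ Y ∈ G.C v, ∀ M, c M Y ∈ Y := by
    intro v Y hY M
    by_cases h1 : M = (redWord h).reverse ∧ Y = X
    · rw [hc1 M Y h1, h1.2]; exact he'
    · exact (hc2 M Y h1).1 (nonempty_of_mem_C hY)
  -- The length bound keeps words strictly beyond `h e` and `h e'` out of the comparison; only these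
  -- two words themselves have to be excluded.
  have key : ∀ M : List (E × Bool), FreeGroup.IsReduced M.reverse → M.length ≤ wordLength h + 1 →
      M ≠ (e, true) :: (redWord h).reverse → M ≠ (e', true) :: (redWord h).reverse →
      (G.IsValid τ c M ↔ ξ (FreeGroup.mk M.reverse) = true) := by
    intro M
    induction M with
    | nil => exact fun _ _ _ _ => iff_of_true trivial hξ.one_mem
    | cons a M ih =>
      intro hM hlen h1 h2
      rw [List.reverse_cons] at hM ⊢
      have hM' := (isReduced_append_iff.1 hM).1
      rw [List.length_cons] at hlen
      have hlen' : ∀ x : E, M ≠ (x, true) :: (redWord h).reverse := by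
        rintro x rfl
        rw [List.length_cons, List.length_reverse, ← wordLength_eq] at hlen
        omega
      specialize ih hM' (by omega) (hlen' _) (hlen' _)
      by_cases hg : ξ (FreeGroup.mk M.reverse) = true
      · have hv := ih.2 hg
        have hT := hξ.hasLocalType_endType hτ hM' hg
        rw [← FreeGroup.mul_mk]
        obtain ⟨x, b⟩ := a
        cases b
        · constructor
          · rintro ⟨-, h3⟩
            rw [h3] at hT
            exact (hT.1 x).2 rfl
          · intro h3
            exact ⟨hv, HasLocalType.unique G hT (hξ.hasLocalType_inr hg h3)⟩
        · have hmk : M = (redWord h).reverse → FreeGroup.mk M.reverse = h := by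
            rintro rfl; rw [List.reverse_reverse, mk_redWord]
          constructor
          · rintro ⟨-, h3, h4, -⟩
            rw [h3] at hT
            have h5 : ¬ (M = (redWord h).reverse ∧ G.part x = X) := by
              intro h6
              rw [hc1 _ _ h6] at h4
              exact h2 (by rw [h4, h6.1])
            obtain ⟨y, ⟨hy, hy'⟩, -⟩ := hT.2.2 _ (G.part_mem x)
            have := (hc2 _ _ h5).2 y hy hy'
            rwa [← h4] at this
          · intro h3
            change ξ (FreeGroup.mk M.reverse * FreeGroup.of x) = true at h3
            refine ⟨hv, HasLocalType.unique G hT (hξ.hasLocalType_inl hg h3), ?_, ?_⟩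
            · have h5 : ¬ (M = (redWord h).reverse ∧ G.part x = X) := by
                intro h6
                rw [hmk h6.1] at h3
                have := hξ.eq_of_part_eq hh hhe h3 (by rw [h6.2, hpe])
                exact h1 (by rw [this, h6.1])
              have h6 := (hc2 _ _ h5).2 x (G.mem_part x) h3
              refine hξ.eq_of_part_eq hg h3 h6 ?_
              exact G.eq_part_of_mem (G.part_mem x) (hc _ _ (G.part_mem x) _)
            -- If the path arrived by `f⁻¹` with `f` in the same set as `x`, then `f` and `x` are
            -- both the edge of `ξ` in that set, so the word would not be reduced.
            · intro f hf hp
              obtain ⟨M', rfl⟩ : ∃ M', M = (f, false) :: M' := by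
                cases M with
                | nil => simp at hf
                | cons a M' => exact ⟨M', by simpa using hf⟩
              have h7 : FreeGroup.mk ((f, false) :: M').reverse * FreeGroup.of f =
                  FreeGroup.mk M'.reverse := by
                rw [List.reverse_cons, ← FreeGroup.mul_mk]
                rw [show FreeGroup.mk [(f, false)] = (FreeGroup.of f)⁻¹ from rfl,
                  inv_mul_cancel_right]
              have h8 : ξ (FreeGroup.mk ((f, false) :: M').reverse * FreeGroup.of f) = true := by
                rw [h7]
                refine hξ.of_prefix hM' ?_ hg
                rw [List.reverse_cons]; exact List.prefix_append _ _
              obtain rfl := hξ.eq_of_part_eq hg h8 h3 hp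
              rw [List.reverse_cons, List.append_assoc] at hM
              have := (isReduced_append_iff.1 hM).2.1
              simp at this
      · refine iff_of_false (fun h3 => hg (ih.1 ?_)) (fun h3 => hg ?_)
        · exact h3.of_suffix (List.suffix_cons _ _)
        · exact hξ.of_prefix hM (List.prefix_append _ _) h3
  refine ⟨G.choiceConfig τ c, isConfiguration_choiceConfig hc, ?_, hξe', ?_⟩
  · rw [choiceConfig_eq_true, hrw', List.reverse_append]
    have hV : G.IsValid τ c (redWord h).reverse := by
      refine (key _ ?_ ?_ ?_ ?_).2 ?_
      · rw [List.reverse_reverse]; exact isReduced_redWord h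
      · rw [List.length_reverse, ← wordLength_eq]; omega
      · exact fun h1 => by simpa using congrArg List.length h1
      · exact fun h1 => by simpa using congrArg List.length h1
      · rwa [List.reverse_reverse, mk_redWord]
    refine ⟨hV, ?_, ?_, ?_⟩
    · have h1 := hξ.hasLocalType_endType hτ (M := (redWord h).reverse)
        (by rw [List.reverse_reverse]; exact isReduced_redWord h)
        (by rwa [List.reverse_reverse, mk_redWord])
      rw [List.reverse_reverse, mk_redWord] at h1
      have h2 := HasLocalType.unique G h1 (hξ.hasLocalType_inl hh hhe)
      exact h2.trans (by rw [G.r_eq_of_mem hX he, G.r_eq_of_mem hX he'])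
    · exact (hc1 _ _ ⟨rfl, hpe'.symm⟩).symm
    · intro f hf hp
      refine hhead f ?_ hf
      rw [hpe', ← hp]; exact G.mem_part f
  · intro g hg h1 h2
    rw [Bool.eq_iff_iff, choiceConfig_eq_true, key, List.reverse_reverse, mk_redWord]
    · rw [List.reverse_reverse]; exact isReduced_redWord g
    · rw [List.length_reverse, ← wordLength_eq]; exact hg
    · intro h3
      apply h1
      apply redWord_injective
      rw [hrw, ← List.reverse_reverse (redWord g), h3]; simp
    · intro h3
      apply h2
      apply redWord_injective
      rw [hrw', ← List.reverse_reverse (redWord g), h3]; simp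

/-- Near a configuration that is fixed by `t`, there is a configuration that is not fixed by `t`,
if the given one can be modified beyond a point `h` with `|t⁻¹ h| ≤ |h|`. -/
theorem IsConfiguration.exists_not_fixed (hξ : G.IsConfiguration ξ) {h t : FreeGroup E} {v : V₀}
    {X : Set E} {e e' : E} (hX : X ∈ G.C v) (he : e ∈ X) (he' : e' ∈ X) (hne : e ≠ e')
    (hhe : ξ (h * FreeGroup.of e) = true)
    (hl : wordLength (h * FreeGroup.of e) = wordLength h + 1) (ht : t ≠ 1)
    (htξ : BipartiteSeparatedGraph.translate t ξ = ξ) (hth : wordLength (t⁻¹ * h) ≤ wordLength h) :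
    ∃ η, G.IsConfiguration η ∧ (∀ g, wordLength g ≤ wordLength h → η g = ξ g) ∧
      BipartiteSeparatedGraph.translate t η ≠ η := by
  obtain ⟨η, h1, h2, h3, h4⟩ := hξ.exists_modification hX he he' hne hhe hl
  have hh : ξ h = true :=
    hξ.of_mul (hl.trans (congrArg _ (wordLength_mk_singleton (e, true)).symm)) hhe
  refine ⟨η, h1, fun g hg => ?_, fun h5 => ?_⟩
  -- Otherwise `h e'` would be the predecessor of `h`, hence in `ξ`.
  · have hpe' : wordLength g < wordLength (h * FreeGroup.of e') := by
      by_contra hc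
      have hlt : wordLength (h * FreeGroup.of e') < wordLength h + 1 := by omega
      rcases redWord_mul_letter h (e', true) with h6 | h6
      · exact absurd (wordLength_mul_letter_iff.2 h6) hlt.ne
      · have h7 := hξ.of_prefix (isReduced_redWord h) (L' := redWord (h * FreeGroup.of e'))
          (by rw [h6]; exact List.prefix_append _ _) (by rwa [mk_redWord])
        rw [mk_redWord, h3] at h7
        simp at h7
    refine h4 g (by omega) ?_ ?_
    · rintro rfl; omega
    · rintro rfl; omega
  -- If `η` were fixed it would contain `t⁻¹ h e'`. This has length at most `|h| + 1` and differs
  -- from `h e'`, so it lies in `ξ` too (directly so if it is `h e`). Invariance of `ξ` then puts `h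
  -- e'` in `ξ`.
  · have h6 : η (t⁻¹ * (h * FreeGroup.of e')) = true := by
      have := congrFun h5 (h * FreeGroup.of e')
      rw [BipartiteSeparatedGraph.translate, h2] at this
      exact this
    have h7 : ξ (t⁻¹ * (h * FreeGroup.of e')) = true := by
      by_cases h8 : t⁻¹ * (h * FreeGroup.of e') = h * FreeGroup.of e
      · rw [h8]; exact hhe
      · rw [← h4 _ _ h8 _]
        · exact h6
        · have h9 := wordLength_mul_le (t⁻¹ * h) (FreeGroup.of e')
          have h10 : wordLength (FreeGroup.of e') = 1 := wordLength_mk_singleton (e', true)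
          rw [← mul_assoc]
          omega
        · intro h9
          exact ht (by simpa using h9)
    have h8 := congrFun htξ (h * FreeGroup.of e')
    rw [BipartiteSeparatedGraph.translate, h7, h3] at h8
    simp at h8

end modification
-- Admissible paths as elements of the free group
section walks

variable {V₀ V₁ E : Type*} {G : BipartiteSeparatedGraph V₀ V₁ E}

/-- The word `e₁⁻¹ e₂ e₃⁻¹ e₄ ⋯` with `n` letters. -/
def walkList (e : ℕ → E) (n : ℕ) : List (E × Bool) :=
  (List.range n).map fun i => (e (i + 1), decide (Odd i))

/-- The group element `e₁⁻¹ e₂ e₃⁻¹ e₄ ⋯` given by a word with `n` letters. -/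
def walk (e : ℕ → E) (n : ℕ) : FreeGroup E := FreeGroup.mk (walkList e n)

theorem walkList_zero (e : ℕ → E) : walkList e 0 = [] := rfl

theorem walk_zero (e : ℕ → E) : walk e 0 = 1 := rfl

theorem walkList_succ (e : ℕ → E) (n : ℕ) :
    walkList e (n + 1) = walkList e n ++ [(e (n + 1), decide (Odd n))] := by
  simp [walkList, List.range_succ]

theorem length_walkList (e : ℕ → E) (n : ℕ) : (walkList e n).length = n := by
  simp [walkList]

theorem walkList_congr {e e' : ℕ → E} {n : ℕ} (h : ∀ i, 1 ≤ i → i ≤ n → e i = e' i) :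
    walkList e n = walkList e' n := by
  refine List.map_congr_left fun i hi => ?_
  rw [h (i + 1) (by omega) (by have := List.mem_range.1 hi; omega)]

theorem walk_congr {e e' : ℕ → E} {n : ℕ} (h : ∀ i, 1 ≤ i → i ≤ n → e i = e' i) :
    walk e n = walk e' n :=
  congrArg _ (walkList_congr h)

theorem walk_odd (e : ℕ → E) (j : ℕ) :
    walk e (2 * j + 1) = walk e (2 * j) * (FreeGroup.of (e (2 * j + 1)))⁻¹ := by
  have h : decide (Odd (2 * j)) = false := by simp
  rw [walk, walkList_succ, ← FreeGroup.mul_mk, h]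
  rfl

theorem walk_even (e : ℕ → E) (j : ℕ) :
    walk e (2 * j + 2) = walk e (2 * j + 1) * FreeGroup.of (e (2 * j + 2)) := by
  have h : decide (Odd (2 * j + 1)) = true := by simp
  rw [walk, walkList_succ, ← FreeGroup.mul_mk, h]
  rfl

theorem IsAdmissible.mono {e : ℕ → E} {m n : ℕ} (h : G.IsAdmissible e n) (hmn : m ≤ n) :
    G.IsAdmissible e m :=
  ⟨fun i h1 h2 => h.1 i h1 (by omega), fun i h1 h2 => h.2 i h1 (by omega)⟩

theorem IsAdmissible.congr {e e' : ℕ → E} {n : ℕ} (h : G.IsAdmissible e n)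
    (he : ∀ i, 1 ≤ i → i ≤ n → e i = e' i) : G.IsAdmissible e' n := by
  refine ⟨fun i h1 h2 h3 => ?_, fun i h1 h2 h3 => ?_⟩
  · rw [← he i h1 (by omega), ← he (i + 1) (by omega) (by omega)]
    exact h.1 i h1 h2 h3
  · rw [← he i h1 (by omega), ← he (i + 1) (by omega) (by omega)]
    exact h.2 i h1 h2 h3

theorem IsAdmissible.succ {e : ℕ → E} {n : ℕ} (h : G.IsAdmissible e n)
    (ho : 1 ≤ n → Odd n → G.r (e n) = G.r (e (n + 1)) ∧ G.part (e n) ≠ G.part (e (n + 1)))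
    (he : 1 ≤ n → Even n → G.s (e n) = G.s (e (n + 1)) ∧ e n ≠ e (n + 1)) :
    G.IsAdmissible e (n + 1) := by
  refine ⟨fun i h1 h2 h3 => ?_, fun i h1 h2 h3 => ?_⟩
  · rcases (show i ≤ n by omega).eq_or_lt with rfl | h4
    · exact ho h1 h3
    · exact h.1 i h1 h4 h3
  · rcases (show i ≤ n by omega).eq_or_lt with rfl | h4
    · exact he h1 h3
    · exact h.2 i h1 h4 h3

/-- Paths are functions on `ℕ` with irrelevant values beyond their length, so a path is extended by
overwriting its next value. -/
theorem IsAdmissible.update_succ {e : ℕ → E} {n : ℕ} (h : G.IsAdmissible e n) {f : E}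
    (ho : 1 ≤ n → Odd n → G.r (e n) = G.r f ∧ G.part (e n) ≠ G.part f)
    (he : 1 ≤ n → Even n → G.s (e n) = G.s f ∧ e n ≠ f) :
    G.IsAdmissible (Function.update e (n + 1) f) (n + 1) := by
  refine IsAdmissible.succ (h.congr fun i _ h2 => ?_) ?_ ?_
  · rw [Function.update_of_ne (by omega)]
  · rwa [Function.update_of_ne (by omega), Function.update_self]
  · rwa [Function.update_of_ne (by omega), Function.update_self]

theorem walkList_update_succ (e : ℕ → E) (n : ℕ) (f : E) :
    walkList (Function.update e (n + 1) f) (n + 1) = walkList e n ++ [(f, decide (Odd n))] := by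
  rw [walkList_succ, Function.update_self, walkList_congr]
  intro i _ h2
  rw [Function.update_of_ne (by omega)]

theorem walk_update_succ (e : ℕ → E) (n : ℕ) (f : E) :
    walk (Function.update e (n + 1) f) n = walk e n :=
  walk_congr fun i _ h2 => by rw [Function.update_of_ne (by omega)]

theorem IsAdmissible.ne_succ {e : ℕ → E} {n i : ℕ} (h : G.IsAdmissible e n) (h1 : 1 ≤ i)
    (h2 : i < n) : e i ≠ e (i + 1) := by
  rcases Nat.even_or_odd i with h3 | h3
  · exact (h.2 i h1 h2 h3).2
  · exact fun h4 => (h.1 i h1 h2 h3).2 (by rw [h4])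

/-- Consecutive edges of an admissible path are distinct: at the even turns by definition, at the
odd turns because their parts differ. -/
theorem IsAdmissible.isReduced {e : ℕ → E} {n : ℕ} (h : G.IsAdmissible e n) :
    FreeGroup.IsReduced (walkList e n) := by
  induction n with
  | zero => exact FreeGroup.IsReduced.nil
  | succ n ih =>
    rw [walkList_succ]
    refine isReduced_append_iff.2 ⟨ih (h.mono (by omega)), FreeGroup.IsReduced.singleton, ?_⟩
    intro a ha b hb hab
    cases n with
    | zero => simp [walkList_zero] at ha
    | succ n =>
      rw [walkList_succ] at ha
      obtain rfl : (e (n + 1), decide (Odd n)) = a := by simpa using ha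
      obtain rfl : (e (n + 1 + 1), decide (Odd (n + 1))) = b := by simpa using hb
      exact absurd hab (h.ne_succ (by omega) (by omega))

theorem IsAdmissible.redWord_walk {e : ℕ → E} {n : ℕ} (h : G.IsAdmissible e n) :
    redWord (walk e n) = walkList e n :=
  redWord_mk h.isReduced

theorem IsAdmissible.wordLength_walk {e : ℕ → E} {n : ℕ} (h : G.IsAdmissible e n) :
    wordLength (walk e n) = n := by
  rw [wordLength_eq, h.redWord_walk, length_walkList]

variable {ξ : FreeGroup E → Bool}

/-- The elements of a configuration of type `w ∈ E^{0,1}` are given by admissible paths that start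
at `w`. -/
theorem IsConfiguration.exists_walkList_eq [Nonempty E] (hξ : G.IsConfiguration ξ) {w : V₁}
    (hw : G.HasLocalType ξ 1 (.inr w)) {g : FreeGroup E} (hg : ξ g = true) :
    ∃ e n, G.IsAdmissible e n ∧ (1 ≤ n → G.s (e 1) = w) ∧ walkList e n = redWord g := by
  have key : ∀ M : List (E × Bool), FreeGroup.IsReduced M.reverse →
      ξ (FreeGroup.mk M.reverse) = true →
      ∃ e n, G.IsAdmissible e n ∧ (1 ≤ n → G.s (e 1) = w) ∧ walkList e n = M.reverse := by
    intro M
    induction M with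
    | nil =>
      refine fun _ _ => ⟨fun _ => Classical.arbitrary E, 0, ⟨?_, ?_⟩, ?_, rfl⟩
      · intro i h1 h2; omega
      · intro i h1 h2; omega
      · intro h; omega
    | cons a M ih =>
      intro hM h
      rw [List.reverse_cons] at hM h ⊢
      have hM' := (isReduced_append_iff.1 hM).1
      have h' := hξ.of_prefix hM (List.prefix_append _ _) h
      obtain ⟨e, n, h1, h2, h3⟩ := ih hM' h'
      have hT := hξ.hasLocalType_endType hw hM' h'
      rw [← FreeGroup.mul_mk] at h
      -- Three facts on the last letter before `a`: `a` does not cancel it, its inverse leads back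
      -- into `ξ`, and it determines the type of the present point. The parity of `n` then fixes the
      -- sign of `a`.
      have hlast : ∀ m, n = m + 1 → (e n, !decide (Odd n)) ≠ (a.1, !a.2) ∧
          ξ (FreeGroup.mk M.reverse * FreeGroup.mk [(e n, decide (Odd n))]) = true ∧
          G.endType (.inr w) M = G.endType (.inr w) [(e n, !decide (Odd n))] := by
        rintro m rfl
        have h5 : (!decide (Odd (m + 1))) = decide (Odd m) := by
          by_cases h : Odd m <;> simp [h, Nat.odd_add_one]
        rw [walkList_succ] at h3
        rw [h5]
        have h6 : M = (e (m + 1), decide (Odd m)) :: (walkList e m).reverse := by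
          rw [← List.reverse_reverse M, ← h3]; simp
        refine ⟨fun h7 => ?_, ?_, ?_⟩
        · rw [← h3, h7, List.append_assoc] at hM
          have := (isReduced_append_iff.1 hM).2.1
          simp at this
        · rw [← h3] at hM' h' ⊢
          rw [← FreeGroup.mul_mk, show FreeGroup.mk [(e (m + 1), decide (Odd m))] =
            (FreeGroup.mk [(e (m + 1), decide (Odd (m + 1)))])⁻¹ by
              rw [← h5]; rfl, inv_mul_cancel_right]
          exact hξ.of_prefix hM' (List.prefix_append _ _) h'
        · rw [h6]
          by_cases h : Odd m <;> simp [h, endType]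
      obtain ⟨x, b⟩ := a
      refine ⟨Function.update e (n + 1) x, n + 1, h1.update_succ ?_ ?_, ?_, ?_⟩
      · intro h4 h5
        obtain ⟨h6, h7, h8⟩ := hlast (n - 1) (by omega)
        simp only [h5, decide_true, Bool.not_true] at h6 h7 h8
        rw [h8] at hT
        cases b with
        | false => simp [hT.1 x, show FreeGroup.mk [(x, false)] = (FreeGroup.of x)⁻¹ from rfl] at h
        | true =>
          refine ⟨(hT.2.1 x h).symm, fun h9 => h6 ?_⟩
          rw [hξ.eq_of_part_eq h' h7 h h9]; rfl
      · intro h4 h5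
        obtain ⟨h6, h7, h8⟩ := hlast (n - 1) (by omega)
        have h5' : ¬ Odd n := Nat.not_odd_iff_even.2 h5
        simp only [h5', decide_false, Bool.not_false] at h6 h7 h8
        rw [h8] at hT
        cases b with
        | false =>
          refine ⟨((hT.1 x).1 h).symm, fun h9 => h6 ?_⟩
          rw [h9]; rfl
        | true => simp [hT.2 x, show FreeGroup.mk [(x, true)] = FreeGroup.of x from rfl] at h
      · intro _
        cases n with
        | zero =>
          have hM0 : M = [] := by simpa [walkList_zero] using h3.symm
          subst hM0
          rw [Function.update_self]
          cases b with
          | false => exact (hT.1 x).1 h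
          | true =>
            have := hT.2 x
            rw [show FreeGroup.of x = FreeGroup.mk [(x, true)] from rfl, h] at this
            simp at this
        | succ n =>
          rw [Function.update_of_ne (by omega)]
          exact h2 (by omega)
      · rw [walkList_update_succ, h3]
        congr 3
        rcases Nat.eq_zero_or_pos n with rfl | hn
        · have hM0 : M = [] := by simpa [walkList_zero] using h3.symm
          subst hM0
          cases b with
          | false => simp
          | true =>
            have := hT.2 x
            rw [show FreeGroup.of x = FreeGroup.mk [(x, true)] from rfl, h] at this
            simp at this
        · obtain ⟨h6, h7, h8⟩ := hlast (n - 1) (by omega)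
          rw [h8] at hT
          by_cases h5 : Odd n
          · simp only [h5, decide_true, Bool.not_true] at hT ⊢
            cases b with
            | true => rfl
            | false =>
              have := hT.1 x
              rw [show (FreeGroup.of x)⁻¹ = FreeGroup.mk [(x, false)] from rfl, h] at this
              simp at this
          · simp only [h5, decide_false, Bool.not_false] at hT ⊢
            cases b with
            | false => rfl
            | true =>
              have := hT.2 x
              rw [show FreeGroup.of x = FreeGroup.mk [(x, true)] from rfl, h] at this
              simp at this
  have := key (redWord g).reverse
  rw [List.reverse_reverse, mk_redWord] at this
  exact this (isReduced_redWord g) hg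

/-- If a path in a configuration starts at the vertex `s (x 1)` of `E^{0,1}`, then either it
stays in the configuration, or the configuration takes another edge at some point. -/
theorem IsConfiguration.walk_mem_or (hξ : G.IsConfiguration ξ) {g : FreeGroup E} {x : ℕ → E}
    (hg : ξ g = true) (hT : G.HasLocalType ξ g (.inr (G.s (x 1)))) {n : ℕ}
    (hx : G.IsAdmissible x (2 * n + 1)) :
    (ξ (g * walk x (2 * n + 1)) = true ∧
        G.HasLocalType ξ (g * walk x (2 * n + 1)) (.inl (G.r (x (2 * n + 1))))) ∨
      ∃ j e, j < n ∧ ξ (g * walk x (2 * j + 1) * FreeGroup.of e) = true ∧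
        G.part e = G.part (x (2 * j + 2)) ∧ e ≠ x (2 * j + 2) := by
  induction n with
  | zero =>
    left
    rw [walk_odd]
    have h1 := (hT.1 (x 1)).2 rfl
    have h2 : g * (walk x (2 * 0) * (FreeGroup.of (x (2 * 0 + 1)))⁻¹) =
        g * (FreeGroup.of (x 1))⁻¹ := by
      simp [walk_zero]
    rw [h2]
    exact ⟨h1, hξ.hasLocalType_mul_inv hg h1⟩
  | succ n ih =>
    rcases ih (hx.mono (by omega)) with ⟨h1, h2⟩ | ⟨j, e, h1, h2⟩
    · have ho := hx.1 (2 * n + 1) (by omega) (by omega) ⟨n, rfl⟩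
      have he := hx.2 (2 * n + 2) (by omega) (by omega) ⟨n + 1, by ring⟩
      -- Only here can `ξ` leave the path: it picks some edge of the set containing `x (2 * n + 2)`.
      -- From a point of type in `E^{0,1}` all edges are present.
      obtain ⟨e, ⟨h3, h4⟩, -⟩ := h2.2.2 (G.part (x (2 * n + 2))) (by
        rw [ho.1]; exact G.part_mem _)
      by_cases h5 : e = x (2 * n + 2)
      · left
        rw [h5, mul_assoc, ← walk_even] at h4
        have h6 : G.HasLocalType ξ (g * walk x (2 * n + 2)) (.inr (G.s (x (2 * n + 2)))) := by
          rw [walk_even, ← mul_assoc] at h4 ⊢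
          exact hξ.hasLocalType_mul_of h1 h4
        have h7 := (h6.1 (x (2 * n + 3))).2 he.1.symm
        rw [mul_assoc] at h7
        have h8 := walk_odd x (n + 1)
        rw [show 2 * (n + 1) = 2 * n + 2 by ring] at h8 ⊢
        rw [h8]
        refine ⟨h7, ?_⟩
        rw [← mul_assoc] at h7 ⊢
        exact hξ.hasLocalType_mul_inv h4 h7
      · exact Or.inr ⟨n, e, by omega, h4,
          (G.eq_part_of_mem (G.part_mem _) h3).symm, h5⟩
    · exact Or.inr ⟨j, e, by omega, h2⟩

end walks
-- Consequences of the absence and of the presence of entries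
section conditionL

variable {V₀ V₁ E : Type*} {G : BipartiteSeparatedGraph V₀ V₁ E}

theorem two_le_encard_of_ne {X : Set E} {e e' : E} (he : e ∈ X) (he' : e' ∈ X) (hne : e ≠ e') :
    2 ≤ X.encard := by
  rw [← Set.encard_pair hne]
  exact Set.encard_le_encard (Set.pair_subset he he')

/-- If no path that starts at `w` has a choice, then all configurations of type `w` contain
all the admissible paths that start at `w`. -/
theorem IsConfiguration.walk_mem {ξ : FreeGroup E → Bool} (hξ : G.IsConfiguration ξ) {x : ℕ → E}
    (hw : G.HasLocalType ξ 1 (.inr (G.s (x 1)))) (hne : ∀ t, ¬ G.IsEntry x t x) {n : ℕ}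
    (hx : G.IsAdmissible x n) : ξ (walk x n) = true := by
  -- An alternative to `x (2 * j + 2)` in its set would make the first `2 * j + 1` edges of `x` an
  -- entry.
  have hno : ∀ (j : ℕ) (e : E), G.IsAdmissible x (2 * j + 2) → G.part e = G.part (x (2 * j + 2)) →
      e = x (2 * j + 2) := by
    intro j e hj he
    by_contra hne'
    have ho := hj.1 (2 * j + 1) (by omega) (by omega) ⟨j, rfl⟩
    refine hne (j + 1) ⟨by omega, hj.mono (by omega), rfl, G.part (x (2 * j + 2)), ?_, ?_, ?_⟩
    · rw [show 2 * (j + 1) - 1 = 2 * j + 1 by omega, ho.1]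
      exact G.part_mem _
    · exact two_le_encard_of_ne (he ▸ G.mem_part e) (G.mem_part _) hne'
    · exact ho.2.symm
  have hodd : ∀ m, G.IsAdmissible x (2 * m + 1) → ξ (walk x (2 * m + 1)) = true ∧
        G.HasLocalType ξ (walk x (2 * m + 1)) (.inl (G.r (x (2 * m + 1)))) := by
    intro m hm
    have := hξ.walk_mem_or hξ.one_mem hw hm
    simp only [one_mul] at this
    rcases this with h | ⟨j, e, h1, -, h2, h3⟩
    · exact h
    · exact absurd (hno j e (hm.mono (by omega)) h2) h3
  rcases Nat.even_or_odd' n with ⟨m, rfl | rfl⟩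
  · cases m with
    | zero => exact hξ.one_mem
    | succ m =>
      obtain ⟨-, h2⟩ := hodd m (hx.mono (by omega))
      have ho := hx.1 (2 * m + 1) (by omega) (by omega) ⟨m, rfl⟩
      obtain ⟨e, ⟨h3, h4⟩, -⟩ := h2.2.2 (G.part (x (2 * m + 2))) (by
        rw [ho.1]; exact G.part_mem _)
      have h5 := hno m e hx (G.eq_part_of_mem (G.part_mem _) h3).symm
      rw [show 2 * (m + 1) = 2 * m + 2 by ring, walk_even, ← h5]
      exact h4
  · exact (hodd m hx).1

/-- Over the base vertex of a cycle without entry the configuration is unique, so it is isolated and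
fixed by the inverse of the group element of the cycle. -/
theorem conditionL_of_isTopologicallyFree [Finite E]
    (h : G.canonicalPartialAction.IsTopologicallyFree) : G.ConditionL := by
  by_contra hL
  simp only [ConditionL, not_forall, not_exists] at hL
  obtain ⟨e, k, he, hno⟩ := hL
  have hE : Nonempty E := ⟨e 1⟩
  obtain ⟨⟨hk, hadm, hclosed⟩, -, -⟩ := he
  -- Every element of `ξ` is given by an admissible path from the base vertex, and without entries
  -- `ξ'` contains all of these. Being an entry depends only on the source of the first edge, so the
  -- absence of entries passes from `e` to `x`.
  have hle : ∀ ξ ξ' : G.Omega, G.HasLocalType ξ.1 1 (.inr (G.s (e 1))) →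
      G.HasLocalType ξ'.1 1 (.inr (G.s (e 1))) → ∀ g, ξ.1 g = true → ξ'.1 g = true := by
    intro ξ ξ' hξ hξ' g hg
    obtain ⟨x, n, h1, h2, h3⟩ := ξ.2.exists_walkList_eq hξ hg
    have h4 : g = walk x n := by rw [walk, h3, mk_redWord]
    rw [h4]
    rcases Nat.eq_zero_or_pos n with rfl | hn
    · exact ξ'.2.one_mem
    · refine ξ'.2.walk_mem (by rwa [h2 hn]) (fun t ht => hno x t ?_) h1
      exact ⟨ht.1, ht.2.1, h2 hn, ht.2.2.2⟩
  have huniq : ∀ ξ ξ' : G.Omega, G.HasLocalType ξ.1 1 (.inr (G.s (e 1))) →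
      G.HasLocalType ξ'.1 1 (.inr (G.s (e 1))) → ξ = ξ' := fun ξ ξ' hξ hξ' =>
    Omega.ext fun g => Bool.eq_iff_iff.2 ⟨hle ξ ξ' hξ hξ' g, hle ξ' ξ hξ' hξ g⟩
  obtain ⟨ξ, hξ⟩ := G.exists_hasLocalType_one (.inr (G.s (e 1)))
  have hmem : ξ.1 (walk e (2 * k)) = true :=
    ξ.2.walk_mem hξ (fun t ht => hno e t ht) hadm
  have htype : G.HasLocalType ξ.1 (walk e (2 * k)) (.inr (G.s (e 1))) := by
    obtain ⟨m, rfl⟩ : ∃ m, k = m + 1 := ⟨k - 1, by omega⟩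
    have h1 : ξ.1 (walk e (2 * m + 1)) = true :=
      ξ.2.walk_mem hξ (fun t ht => hno e t ht) (hadm.mono (by omega))
    rw [hclosed, show 2 * (m + 1) = 2 * m + 2 by ring, walk_even]
    rw [show 2 * (m + 1) = 2 * m + 2 by ring, walk_even] at hmem
    exact ξ.2.hasLocalType_mul_of h1 hmem
  have hne : (walk e (2 * k))⁻¹ ≠ 1 := by
    rw [Ne, inv_eq_one]
    intro h1
    have h2 := hadm.wordLength_walk
    rw [h1, wordLength_one] at h2
    omega
  have hopen : IsOpen {η : G.Omega | G.HasLocalType η.1 1 (.inr (G.s (e 1)))} :=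
    (G.isClopen_hasLocalType 1 (.inr (G.s (e 1)))).isOpen.preimage continuous_subtype_val
  have hsub : ξ ∈ interior {x | ∃ hx : x ∈ G.canonicalPartialAction.U (walk e (2 * k))⁻¹⁻¹,
      (G.canonicalPartialAction.θ (walk e (2 * k))⁻¹ ⟨x, hx⟩ : G.Omega) = x} := by
    refine mem_interior.2 ⟨_, ?_, hopen, hξ⟩
    intro η hη
    obtain rfl := huniq η ξ hη hξ
    refine ⟨?_, huniq _ _ ?_ hη⟩
    · rw [inv_inv]; exact hmem
    · refine (G.hasLocalType_translate _ _ _ _).2 ?_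
      have h1 : G.HasLocalType η.1 ((walk e (2 * k))⁻¹⁻¹ * 1) (.inr (G.s (e 1))) := by
        rwa [inv_inv, mul_one]
      exact h1
  rw [h _ hne] at hsub
  exact hsub

/-- The shift is even so that forward and backward edges keep their roles. -/
theorem IsAdmissible.shift {e : ℕ → E} {n a : ℕ} (h : G.IsAdmissible e (2 * a + n)) :
    G.IsAdmissible (fun j => e (2 * a + j)) n := by
  refine ⟨fun i h1 h2 h3 => ?_, fun i h1 h2 h3 => ?_⟩
  · exact h.1 (2 * a + i) (by omega) (by omega) ((even_two_mul a).add_odd h3)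
  · exact h.2 (2 * a + i) (by omega) (by omega) ((even_two_mul a).add h3)

/-- Under condition (L), a long admissible path goes through a vertex at which some entry starts. -/
theorem ConditionL.exists_isEntry [Finite V₁] (hL : G.ConditionL) {e : ℕ → E} {n : ℕ}
    (he : G.IsAdmissible e n) (hn : 2 * Nat.card V₁ + 1 ≤ n) :
    ∃ i x t, 2 * i + 1 ≤ n ∧ G.IsEntry x t (fun j => e (2 * i + j)) := by
  classical
  -- The path visits `Nat.card V₁ + 1` vertices of `E^{0,1}` at the edges of odd index, so one is
  -- repeated. A repetition with minimal gap `d` provides the distinctness required of a cycle.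
  have hP : ∃ d, 1 ≤ d ∧ ∃ a, a + d ≤ Nat.card V₁ ∧
      G.s (e (2 * a + 1)) = G.s (e (2 * (a + d) + 1)) := by
    have _ := Fintype.ofFinite V₁
    obtain ⟨i, j, hij, heq⟩ := Fintype.exists_ne_map_eq_of_card_lt
      (fun i : Fin (Nat.card V₁ + 1) => G.s (e (2 * i + 1)))
      (by rw [Fintype.card_fin, Nat.card_eq_fintype_card]; omega)
    rcases lt_or_gt_of_ne (fun h => hij (Fin.ext h)) with h | h
    · refine ⟨j - i, by omega, i, by omega, ?_⟩
      rw [heq, show (i : ℕ) + (j - i) = j by omega]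
    · refine ⟨i - j, by omega, j, by omega, ?_⟩
      rw [← heq, show (j : ℕ) + (i - j) = i by omega]
  obtain ⟨d, ⟨hd, a, had, hwa⟩, hmin⟩ :
      ∃ d, (1 ≤ d ∧ ∃ a, a + d ≤ Nat.card V₁ ∧
        G.s (e (2 * a + 1)) = G.s (e (2 * (a + d) + 1))) ∧
        ∀ d', 1 ≤ d' → d' < d → ∀ a, a + d' ≤ Nat.card V₁ →
          G.s (e (2 * a + 1)) ≠ G.s (e (2 * (a + d') + 1)) :=
    ⟨Nat.find hP, Nat.find_spec hP, fun d' h1 h2 b h3 h4 => Nat.find_min hP h2 ⟨h1, b, h3, h4⟩⟩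
  set f : ℕ → E := fun j => e (2 * a + j) with hf
  have hfa : G.IsAdmissible f (2 * d + 1) := (he.mono (by omega)).shift
  have hs : ∀ j, 1 ≤ j → j ≤ d → G.s (f (2 * j)) = G.s (e (2 * (a + j) + 1)) := by
    intro j h1 h2
    have := (hfa.2 (2 * j) (by omega) (by omega) (even_two_mul j)).1
    rw [this]
    exact congrArg (fun m => G.s (e m)) (by ring)
  have hdist : ∀ i j, 1 ≤ i → i ≤ j → j < d → G.s (f (2 * i - 1)) ≠ G.s (f (2 * j)) := by
    intro i j h1 h2 h3 h4
    rw [hs j (by omega) (by omega)] at h4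
    refine hmin (j - i + 1) (by omega) (by omega) (a + i - 1) (by omega) ?_
    rw [show a + i - 1 + (j - i + 1) = a + j by omega, ← h4]
    exact congrArg (fun m => G.s (e m)) (by omega)
  have hclosed : G.s (f 1) = G.s (f (2 * d)) := by rw [hs d hd le_rfl, ← hwa]
  have ho1 := hfa.1 1 le_rfl (by omega) odd_one
  -- The closed path `f` can fail to be a cycle only if it returns along its first edge.
  by_cases h1 : f 1 = f (2 * d)
  · have hd2 : 2 ≤ d := by
      by_contra hd2
      obtain rfl : d = 1 := by omega
      exact hfa.ne_succ le_rfl (by omega) h1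
    have hlast := hfa.1 (2 * d - 1) (by omega) (by omega) ⟨d - 1, by omega⟩
    rw [show 2 * d - 1 + 1 = 2 * d by omega, ← h1] at hlast
    -- Both `f 2` and `f (2 * d - 1)` end at `r (f 1)`, in parts other than that of `f 1`. If they
    -- coincide, a vertex is repeated with gap `d - 2`, or `f 2 = f 3` when `d = 2`. If they are
    -- distinct in one part, `f 1` alone is an entry. If the parts differ, cutting off the tail `f
    -- 1` leaves the cycle `f 3, …, f (2 * d - 1), f 2`.
    by_cases h2 : G.part (f 2) = G.part (f (2 * d - 1))
    · by_cases h3 : f 2 = f (2 * d - 1)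
      · exfalso
        rcases hd2.eq_or_lt with rfl | h4
        · exact hfa.ne_succ (i := 2) (by omega) (by omega) h3
        · refine hmin (d - 2) (by omega) (by omega) (a + 1) (by omega) ?_
          have h5 := hs 1 le_rfl hd
          rw [show 2 * 1 = 2 by rfl, h3] at h5
          rw [← h5]
          exact congrArg (fun m => G.s (e m)) (by omega)
      · refine ⟨a, f, 1, by omega, le_rfl, hfa.mono (by omega), rfl, G.part (f 2), ?_, ?_, ?_⟩
        · change G.part (f 2) ∈ G.C (G.r (f 1))
          rw [ho1.1]; exact G.part_mem _
        · exact two_le_encard_of_ne (G.mem_part _) (h2 ▸ G.mem_part _) h3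
        · exact ho1.2.symm
    · have hc : G.IsAdmissible (Function.update (fun j => f (2 * 1 + j)) (2 * d - 3 + 1) (f 2))
          (2 * d - 3 + 1) := by
        refine IsAdmissible.update_succ ((hfa.mono (by omega)).shift) ?_ ?_
        · intro _ _
          rw [show 2 * 1 + (2 * d - 3) = 2 * d - 1 by omega]
          exact ⟨hlast.1.trans ho1.1, fun h => h2 h.symm⟩
        · rintro - ⟨m, hm⟩
          omega
      rw [show 2 * d - 3 + 1 = 2 * (d - 1) by omega] at hc
      have h23 := hfa.2 2 (by omega) (by omega) even_two
      have hc1 : Function.update (fun j => f (2 * 1 + j)) (2 * (d - 1)) (f 2) 1 = f 3 := by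
        rw [Function.update_of_ne (by omega)]
      have hcyc : G.IsCycle (Function.update (fun j => f (2 * 1 + j)) (2 * (d - 1)) (f 2))
          (d - 1) := by
        refine ⟨⟨by omega, hc, ?_⟩, ?_, ?_⟩
        · rw [hc1, Function.update_self]; exact h23.1.symm
        · rw [hc1, Function.update_self]; exact h23.2.symm
        · intro i j h4 h5 h6
          rw [Function.update_of_ne (by omega), Function.update_of_ne (by omega)]
          have := hdist (i + 1) (j + 1) (by omega) (by omega) (by omega)
          rwa [show 2 * (i + 1) - 1 = 2 * 1 + (2 * i - 1) by omega,
            show 2 * (j + 1) = 2 * 1 + 2 * j by omega] at this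
      obtain ⟨x, t, h4, h5, h6, h7⟩ := hL _ _ hcyc
      refine ⟨a + 1, x, t, by omega, h4, h5, ?_, h7⟩
      rw [h6, hc1]
      exact congrArg (fun m => G.s (e m)) (by ring)
  · obtain ⟨x, t, hx⟩ := hL f d ⟨⟨hd, hfa.mono (by omega), hclosed⟩, h1, hdist⟩
    exact ⟨a, x, t, by omega, hx⟩

end conditionL
-- Condition (L) implies topological freeness
section free

variable {V₀ V₁ E : Type*} {G : BipartiteSeparatedGraph V₀ V₁ E}

/-- The point `ξ` is in the interior of the fixed point set of `t`. -/
def IsStablyFixed (G : BipartiteSeparatedGraph V₀ V₁ E) (t : FreeGroup E)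
    (ξ : FreeGroup E → Bool) : Prop :=
  ∃ N, ∀ η, G.IsConfiguration η → (∀ g, wordLength g ≤ N → η g = ξ g) → translate t η = η

theorem translate_mul (g h : FreeGroup E) (ξ : FreeGroup E → Bool) :
    translate (g * h) ξ = translate g (translate h ξ) := by
  funext k
  simp [translate, mul_assoc]

theorem translate_inv_translate (g : FreeGroup E) (ξ : FreeGroup E → Bool) :
    translate g⁻¹ (translate g ξ) = ξ := by
  funext k
  simp [translate]

/-- Change of base point. Translation by `k` alters lengths by at most `|k|`, which is the amount
added to the radius. -/
theorem IsStablyFixed.conj {t k : FreeGroup E} {ξ : FreeGroup E → Bool}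
    (h : G.IsStablyFixed t ξ) (hξ : G.IsConfiguration ξ) :
    G.IsStablyFixed (k⁻¹ * t * k) (translate k⁻¹ ξ) := by
  obtain ⟨N, hN⟩ := h
  refine ⟨N + wordLength k, fun η hη hag => ?_⟩
  have hk : η k⁻¹ = true := by
    rw [hag k⁻¹ (by rw [wordLength_inv]; omega)]
    simpa [translate] using hξ.one_mem
  have h1 := hN (translate k η) (hη.translate G hk) (fun g hg => by
    have h2 := wordLength_mul_le k⁻¹ g
    rw [wordLength_inv] at h2
    rw [translate, hag _ (by omega)]
    simp [translate])
  rw [translate_mul, translate_mul, h1, translate_inv_translate]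

/-- A basic neighbourhood constrains finitely many group elements, all of which lie in some ball. -/
theorem isStablyFixed_of_mem_interior {t : FreeGroup E} {ξ : G.Omega}
    (h : ξ ∈ interior {x | ∃ hx : x ∈ G.canonicalPartialAction.U t⁻¹,
      (G.canonicalPartialAction.θ t ⟨x, hx⟩ : G.Omega) = x}) : G.IsStablyFixed t ξ.1 := by
  obtain ⟨U, hU, hUo, hξ⟩ := mem_interior.1 h
  obtain ⟨O, hO, rfl⟩ := isOpen_induced_iff.1 hUo
  obtain ⟨I, u, h1, h2⟩ := isOpen_pi_iff.1 hO ξ.1 hξ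
  refine ⟨I.sup wordLength, fun η hη hag => ?_⟩
  obtain ⟨hx, h3⟩ := hU (show (⟨η, hη⟩ : G.Omega) ∈ Subtype.val ⁻¹' O from h2 fun g hg => by
    rw [show (⟨η, hη⟩ : G.Omega).1 g = ξ.1 g from hag g (Finset.le_sup (f := wordLength) hg)]
    exact (h1 g hg).2)
  exact congrArg Subtype.val h3

theorem wordLength_pow {t : FreeGroup E} (ht : FreeGroup.IsCyclicallyReduced (redWord t)) (m : ℕ) :
    wordLength (t ^ m) = m * wordLength t := by
  have h1 : t ^ m = FreeGroup.mk (List.replicate m (redWord t)).flatten := by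
    rw [← FreeGroup.pow_mk, mk_redWord]
  rw [h1, wordLength_eq, redWord_mk (ht.flatten_replicate m).isReduced]
  simp [wordLength_eq]

theorem one_le_wordLength {t : FreeGroup E} (ht : t ≠ 1) : 1 ≤ wordLength t :=
  Nat.one_le_iff_ne_zero.2 fun h => ht (wordLength_eq_zero.1 h)

theorem apply_pow_mul {t : FreeGroup E} {ξ : FreeGroup E → Bool} (h : translate t ξ = ξ) (m : ℕ)
    (g : FreeGroup E) : ξ (t ^ m * g) = ξ g := by
  induction m with
  | zero => simp
  | succ m ih =>
    have := congrFun h (t ^ (m + 1) * g)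
    rw [translate, pow_succ', mul_assoc, inv_mul_cancel_left, ih] at this
    rw [pow_succ', mul_assoc]
    exact this.symm

theorem apply_inv_pow_mul {t : FreeGroup E} {ξ : FreeGroup E → Bool} (h : translate t ξ = ξ)
    (m : ℕ) (g : FreeGroup E) : ξ ((t ^ m)⁻¹ * g) = ξ g := by
  rw [← apply_pow_mul h m, mul_inv_cancel_left]

/-- An element whose length is minimal among the conjugates by elements of a configuration that it
fixes is cyclically reduced. -/
theorem isCyclicallyReduced_of_minimal {t : FreeGroup E} {ξ : FreeGroup E → Bool}
    (hξ : G.IsConfiguration ξ) (ht : ξ t = true)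
    (hmin : ∀ k, ξ k = true → wordLength t ≤ wordLength (k⁻¹ * t * k)) :
    FreeGroup.IsCyclicallyReduced (redWord t) := by
  by_contra hc
  have h1 : wordLength (t * t) ≠ wordLength t + wordLength t := by
    intro h2
    have h3 := isReduced_redWord (t * t)
    rw [redWord_mul h2] at h3
    have h4 := isReduced_append_iff.1 h3
    exact hc ⟨h4.1, h4.2.2⟩
  obtain ⟨y, L, hy, hL⟩ := exists_cancel h1
  obtain ⟨L', hL'⟩ : ∃ L', redWord t = y :: L' := by
    cases hr : redWord t with
    | nil => simp [hr] at hy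
    | cons a M => rw [hr] at hy; exact ⟨M, by simpa using hy⟩
  obtain ⟨L'', rfl⟩ : ∃ L'', L = y :: L'' := by
    cases L with
    | nil =>
      rw [hL] at hL'
      have := (List.cons.inj hL').1
      have := congrArg Prod.snd this
      simp at this
    | cons a M =>
      rw [hL] at hL'
      exact ⟨M, by rw [(List.cons.inj hL').1]⟩
  -- The first letter `y` is in `ξ`, being a prefix of `t`, and conjugating by it shortens `t` by
  -- two letters.
  have h2 : t = FreeGroup.mk [y] * FreeGroup.mk L'' * (FreeGroup.mk [y])⁻¹ := by
    rw [← mk_redWord t, hL, FreeGroup.mul_mk, show (FreeGroup.mk [y])⁻¹ =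
      FreeGroup.mk [(y.1, !y.2)] from rfl, FreeGroup.mul_mk]
    rfl
  have h3 : ξ (FreeGroup.mk [y]) = true := by
    refine hξ.of_prefix (isReduced_redWord t) ?_ (by rwa [mk_redWord])
    rw [hL']
    exact ⟨L', rfl⟩
  have h4 := hmin _ h3
  have h5 : (FreeGroup.mk [y])⁻¹ * t * FreeGroup.mk [y] = FreeGroup.mk L'' := by
    rw [h2]; group
  rw [h5] at h4
  have h6 := wordLength_mk_le L''
  rw [wordLength_eq t, hL] at h4
  simp at h4
  omega

/-- A point of a configuration of type in `E^{0,1}` such that the corresponding conjugate of `t`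
has minimal length. -/
theorem exists_minimal_conj {t : FreeGroup E} {ξ : FreeGroup E → Bool}
    (hξ : G.IsConfiguration ξ) (htξ : translate t ξ = ξ) (ht : t ≠ 1) :
    ∃ k w, ξ k = true ∧ G.HasLocalType ξ k (.inr w) ∧
      ∀ k', ξ k' = true → wordLength (k⁻¹ * t * k) ≤ wordLength (k'⁻¹ * t * k') := by
  obtain ⟨k, hk, hmin⟩ : ∃ k, ξ k = true ∧
      ∀ k', ξ k' = true → wordLength (k⁻¹ * t * k) ≤ wordLength (k'⁻¹ * t * k') := by
    have hne : {k | ξ k = true}.Nonempty := ⟨1, hξ.one_mem⟩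
    obtain ⟨k, hk, hmin⟩ := (InvImage.wf (fun k : FreeGroup E => wordLength (k⁻¹ * t * k))
      Nat.lt_wfRel.wf).has_min _ hne
    exact ⟨k, hk, fun k' hk' => not_lt.1 (hmin k' hk')⟩
  obtain ⟨v, hv⟩ := hξ.localType k hk
  cases v with
  | inr w => exact ⟨k, w, hk, hv, hmin⟩
  | inl v =>
    have hne : k⁻¹ * t * k ≠ 1 := by
      intro h1
      apply ht
      have : t = k * (k⁻¹ * t * k) * k⁻¹ := by group
      rw [this, h1]; group
    obtain ⟨a, L, haL⟩ : ∃ a L, redWord (k⁻¹ * t * k) = a :: L := by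
      cases hr : redWord (k⁻¹ * t * k) with
      | nil => exact absurd (redWord_injective (hr.trans redWord_one.symm)) hne
      | cons a L => exact ⟨a, L, rfl⟩
    -- If the minimum is attained at a point of type in `E^{0,0}`, one step along the axis towards
    -- `t k` permutes the word cyclically, so the length does not grow, and reaches a point of type
    -- in `E^{0,1}`.
    have h1 : k⁻¹ * t * k = FreeGroup.mk [a] * FreeGroup.mk L := by
      rw [FreeGroup.mul_mk, ← mk_redWord (k⁻¹ * t * k), haL]; rfl
    have h2 : ξ (k * FreeGroup.mk [a]) = true := by
      have hc := hξ.translate G (g := k⁻¹) (by rwa [inv_inv])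
      have h3 := hc.of_prefix (isReduced_redWord (k⁻¹ * t * k)) (L' := [a]) (by
        rw [haL]; exact ⟨L, rfl⟩) (by
          rw [mk_redWord, translate, inv_inv]
          have := apply_pow_mul htξ 1 k
          rw [pow_one, hk] at this
          rw [← this]; congr 1; group)
      rwa [translate, inv_inv] at h3
    obtain ⟨e, b⟩ := a
    cases b with
    | false => simp [hv.1 e, show FreeGroup.mk [(e, false)] = (FreeGroup.of e)⁻¹ from rfl] at h2
    | true =>
      refine ⟨_, _, h2, hξ.hasLocalType_mul_of hk h2, fun k' hk' =>
        (?_ : _ ≤ _).trans (hmin k' hk')⟩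
      have h3 : (k * FreeGroup.mk [(e, true)])⁻¹ * t * (k * FreeGroup.mk [(e, true)]) =
          FreeGroup.mk (L ++ [(e, true)]) := by
        rw [← FreeGroup.mul_mk]
        have : FreeGroup.mk L = (FreeGroup.mk [(e, true)])⁻¹ * (k⁻¹ * t * k) := by
          rw [h1]; group
        rw [this]; group
      rw [h3]
      refine (wordLength_mk_le _).trans ?_
      rw [wordLength_eq, haL]; simp

/-- If an entry starts at a point `g` of a configuration, then somewhere beyond `g` the
configuration goes through an edge that may be replaced. -/
theorem IsConfiguration.exists_choice {ξ : FreeGroup E → Bool} (hξ : G.IsConfiguration ξ)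
    {g : FreeGroup E} (hg : ξ g = true) {x e : ℕ → E} {t : ℕ}
    (hT : G.HasLocalType ξ g (.inr (G.s (e 1)))) (hx : G.IsEntry x t e) :
    ∃ y v, ∃ X ∈ G.C v, ∃ f ∈ X, ∃ f' ∈ X, f ≠ f' ∧ ξ (g * y * FreeGroup.of f) = true ∧
      wordLength (y * FreeGroup.of f) = wordLength y + 1 := by
  obtain ⟨ht, hadm, hs, X, hX, hX2, hXne⟩ := hx
  obtain ⟨n, rfl⟩ : ∃ n, t = n + 1 := ⟨t - 1, by omega⟩
  rw [show 2 * (n + 1) - 1 = 2 * n + 1 by omega] at *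
  -- An initial piece of the entry followed by `f` is still admissible, so its word is reduced.
  have hlen : ∀ j f, G.IsAdmissible x (2 * j + 1) → G.r f = G.r (x (2 * j + 1)) →
      G.part f ≠ G.part (x (2 * j + 1)) →
      wordLength (walk x (2 * j + 1) * FreeGroup.of f) = wordLength (walk x (2 * j + 1)) + 1 := by
    intro j f h1 h2 h3
    have h4 : G.IsAdmissible (Function.update x (2 * j + 1 + 1) f) (2 * j + 1 + 1) := by
      refine h1.update_succ (fun _ _ => ⟨h2.symm, h3.symm⟩) ?_
      rintro - ⟨m, hm⟩
      omega
    have h5 := h4.wordLength_walk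
    rw [walk_even, Function.update_self, walk_update_succ] at h5
    rw [h5, h1.wordLength_walk]
  -- Either `ξ` follows the entry to its end and makes a choice in `X`, or it leaves the entry
  -- earlier, and then the edge of the entry is the alternative.
  rcases hξ.walk_mem_or hg (by rwa [hs]) hadm with ⟨h1, h2⟩ | ⟨j, f, hj, h1, h2, h3⟩
  · obtain ⟨f, ⟨hf, hfξ⟩, -⟩ := h2.2.2 X hX
    obtain ⟨f', hf', hne⟩ := Set.exists_ne_of_one_lt_encard (lt_of_lt_of_le (by norm_num) hX2) f
    refine ⟨_, _, X, hX, f, hf, f', hf', hne.symm, hfξ, ?_⟩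
    exact hlen n f hadm (G.r_eq_of_mem hX hf) (by rwa [← G.eq_part_of_mem hX hf])
  · refine ⟨_, _, _, G.part_mem f, f, G.mem_part f, x (2 * j + 2), h2 ▸ G.mem_part _, h3, h1, ?_⟩
    have ho := hadm.1 (2 * j + 1) (by omega) (by omega) ⟨j, rfl⟩
    refine hlen j f (hadm.mono (by omega)) ?_ ?_
    · rw [ho.1]
      exact G.r_eq_of_mem (G.part_mem _) (h2 ▸ G.mem_part f)
    · rw [h2]; exact ho.2.symm

/-- The core of the converse: minimality makes `m ↦ t ^ m` a geodesic axis in `ξ`, along which the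
choice found by (L) is pushed out of the ball of radius `N`. -/
theorem not_isStablyFixed_of_minimal [Finite V₁] (hL : G.ConditionL) {t : FreeGroup E} {w : V₁}
    {ξ : FreeGroup E → Bool} (hξ : G.IsConfiguration ξ) (ht : t ≠ 1)
    (hw : G.HasLocalType ξ 1 (.inr w))
    (hmin : ∀ k, ξ k = true → wordLength t ≤ wordLength (k⁻¹ * t * k)) :
    ¬ G.IsStablyFixed t ξ := by
  rintro ⟨N, hN⟩
  have htξ := hN ξ hξ fun _ _ => rfl
  have hpm : ∀ m, ξ (t ^ m) = true := fun m => by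
    have := apply_pow_mul htξ m 1
    rwa [mul_one, hξ.one_mem] at this
  have htl := one_le_wordLength ht
  have hpow := wordLength_pow
    (isCyclicallyReduced_of_minimal hξ (by simpa using hpm 1) hmin)
  have hE : Nonempty E := by
    cases hr : redWord t with
    | nil => exact absurd (redWord_injective (hr.trans redWord_one.symm)) ht
    | cons a L => exact ⟨a.1⟩
  -- Since `|t| ≥ 1`, the word of `t ^ n` is long enough for `ConditionL.exists_isEntry`.
  obtain ⟨n, hn⟩ : ∃ n, n = 2 * Nat.card V₁ + 1 := ⟨_, rfl⟩
  obtain ⟨e, n', he, -, hwalk⟩ := hξ.exists_walkList_eq hw (hpm n)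
  have hn' : n' = n * wordLength t := by
    rw [← hpow, wordLength_eq, ← hwalk, length_walkList]
  obtain ⟨i, x, τ, hi, hx⟩ := hL.exists_isEntry he (by
    rw [hn', ← hn]; exact Nat.le_mul_of_pos_right n htl)
  have hpre : ∀ j ≤ n', walkList e j <+: redWord (t ^ n) := by
    intro j hj
    obtain ⟨d, rfl⟩ := Nat.exists_eq_add_of_le hj
    rw [← hwalk, walkList, walkList, List.range_add, List.map_append]
    exact List.prefix_append _ _
  have hmem : ∀ j ≤ n', ξ (walk e j) = true := fun j hj =>
    hξ.of_prefix (isReduced_redWord _) (hpre j hj) (by rw [mk_redWord]; exact hpm n)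
  set g := walk e (2 * i) with hgdef
  have hg : ξ g = true := hmem _ (by omega)
  have hT : G.HasLocalType ξ g (.inr (G.s ((fun j => e (2 * i + j)) 1))) := by
    have h1 := hmem (2 * i + 1) hi
    rw [walk_odd] at h1
    exact hξ.hasLocalType_inr hg h1
  have hgl : wordLength g + wordLength (g⁻¹ * t ^ n) = n * wordLength t := by
    obtain ⟨Q, hQ⟩ := hpre (2 * i) (by omega)
    have h1 : g⁻¹ * t ^ n = FreeGroup.mk Q := by
      rw [← mk_redWord (t ^ n), ← hQ, ← FreeGroup.mul_mk]
      exact inv_mul_cancel_left _ _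
    have h2 : FreeGroup.IsReduced Q := (isReduced_append_iff.1 (hQ ▸ isReduced_redWord _)).2.1
    rw [h1, ← hpow, wordLength_eq (t ^ n), ← hQ, wordLength_eq (FreeGroup.mk Q), redWord_mk h2,
      (he.mono (by omega)).wordLength_walk, List.length_append, length_walkList]
  obtain ⟨y, v, X, hX, f, hf, f', hf', hne, hξf, hyf⟩ := hξ.exists_choice hg hT hx
  have hfl : wordLength (FreeGroup.of f) = 1 := wordLength_mk_singleton (f, true)
  -- As `g` lies on the geodesic from `1` to `t ^ n`, its translates `t ^ m g`, and `t ^ (-m) g` for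
  -- `m ≥ n`, lie on the axis at computable distances from `1`.
  have hup : ∀ m, wordLength (t ^ m * g) = m * wordLength t + wordLength g := by
    intro m
    have h1 := wordLength_mul_le (t ^ m) g
    have h2 := wordLength_mul_le (t ^ m * g) (g⁻¹ * t ^ n)
    rw [show t ^ m * g * (g⁻¹ * t ^ n) = t ^ (m + n) by rw [pow_add]; group, hpow, add_mul] at h2
    rw [hpow] at h1
    omega
  have hdown : ∀ m, n ≤ m → wordLength ((t ^ m)⁻¹ * g) + wordLength g = m * wordLength t := by
    intro m hm
    obtain ⟨d, rfl⟩ := Nat.exists_eq_add_of_le hm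
    have h0 : wordLength ((t ^ (n + d))⁻¹ * g) = wordLength (g⁻¹ * t ^ (n + d)) := by
      rw [← wordLength_inv]; congr 1; group
    have h1 := wordLength_mul_le (g⁻¹ * t ^ n) (t ^ d)
    have h2 := wordLength_mul_le g (g⁻¹ * t ^ (n + d))
    rw [mul_assoc, ← pow_add, hpow] at h1
    rw [mul_inv_cancel_left, hpow] at h2
    rw [add_mul] at h2 ⊢
    omega
  have hlen : ∀ a, wordLength (a * (y * FreeGroup.of f)) =
      wordLength a + wordLength (y * FreeGroup.of f) →
      wordLength (a * y) = wordLength a + wordLength y ∧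
        wordLength (a * y * FreeGroup.of f) = wordLength (a * y) + 1 := by
    intro a ha
    have h1 := wordLength_mul_le (a * y) (FreeGroup.of f)
    have h2 := wordLength_mul_le a y
    rw [← mul_assoc] at ha
    omega
  by_cases hA : ∀ m, wordLength (t ^ m * g * (y * FreeGroup.of f)) =
      wordLength (t ^ m * g) + wordLength (y * FreeGroup.of f)
  · obtain ⟨h1, h2⟩ := hlen _ (hA (N + 1))
    rw [hup] at h1
    obtain ⟨η, hη, hag, hnf⟩ := hξ.exists_not_fixed (h := t ^ (N + 1) * g * y) (t := t) hX hf hf'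
      hne (by rw [mul_assoc, mul_assoc, apply_pow_mul htξ, ← mul_assoc, hξf]) h2 ht htξ (by
        have h3 := wordLength_mul_le (t ^ N * g) y
        rw [hup] at h3
        rw [show t⁻¹ * (t ^ (N + 1) * g * y) = t ^ N * g * y by rw [pow_succ']; group, h1, add_mul]
        omega)
    refine hnf (hN η hη fun k hk => hag k (hk.trans ?_))
    have := Nat.le_mul_of_pos_right (N + 1) htl
    omega
  -- Cancellation of `y f` against both `t ^ m' g` and `t ^ (-m) g` would make these cancel against
  -- each other, giving `|t ^ (m' + m)| < (m' + m) |t|`.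
  · have hB : ∀ m, n ≤ m → wordLength ((t ^ m)⁻¹ * g * (y * FreeGroup.of f)) =
        wordLength ((t ^ m)⁻¹ * g) + wordLength (y * FreeGroup.of f) := by
      intro m hm
      by_contra hc
      obtain ⟨m', hm'⟩ := not_forall.1 hA
      have h1 := wordLength_mul_inv_lt hm' hc
      rw [show t ^ m' * g * ((t ^ m)⁻¹ * g)⁻¹ = t ^ (m' + m) by rw [pow_add]; group, hpow, hup,
        add_mul] at h1
      have := hdown m hm
      omega
    -- The extra `n` compensates for `|g| ≤ n |t|`, so that the modified point still has length at
    -- least `N`. The argument is run for `t⁻¹`, which brings this point back towards `1`.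
    obtain ⟨h1, h2⟩ := hlen _ (hB (n + N + 1) (by omega))
    have h3 := hdown (n + N) (by omega)
    have h4 := hdown (n + N + 1) (by omega)
    obtain ⟨η, hη, hag, hnf⟩ := hξ.exists_not_fixed (h := (t ^ (n + N + 1))⁻¹ * g * y) (t := t⁻¹)
      hX hf hf' hne (by rw [mul_assoc, mul_assoc, apply_inv_pow_mul htξ, ← mul_assoc, hξf]) h2
      (inv_ne_one.2 ht) (by conv_lhs => rw [← htξ, translate_inv_translate]) (by
        have h5 : t⁻¹⁻¹ * ((t ^ (n + N + 1))⁻¹ * g * y) = (t ^ (n + N))⁻¹ * g * y := by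
          rw [pow_succ]; group
        have h6 := wordLength_mul_le ((t ^ (n + N))⁻¹ * g) y
        rw [h5]
        rw [add_mul (n + N)] at h4
        omega)
    have h7 : translate t η = η := by
      refine hN η hη fun k hk => hag k (hk.trans ?_)
      have h8 := Nat.le_mul_of_pos_right (N + 1) htl
      have h9 : (n + N + 1) * wordLength t = n * wordLength t + (N + 1) * wordLength t := by ring
      omega
    refine hnf ?_
    conv_lhs => rw [← h7, translate_inv_translate]

theorem isTopologicallyFree_of_conditionL [Finite V₁] (hL : G.ConditionL) :
    G.canonicalPartialAction.IsTopologicallyFree := by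
  intro t ht
  rw [Set.eq_empty_iff_forall_notMem]
  intro ξ hmem
  have hst := isStablyFixed_of_mem_interior hmem
  have htξ : translate t ξ.1 = ξ.1 := hst.choose_spec _ ξ.2 fun _ _ => rfl
  obtain ⟨k, w, hk, hw, hmin⟩ := exists_minimal_conj ξ.2 htξ ht
  refine not_isStablyFixed_of_minimal hL (ξ.2.translate G (g := k⁻¹) (by rwa [inv_inv]))
    (t := k⁻¹ * t * k) (w := w) ?_ ?_ ?_ (hst.conj ξ.2)
  · intro h1
    apply ht
    have : t = k * (k⁻¹ * t * k) * k⁻¹ := by group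
    rw [this, h1]; group
  · rw [hasLocalType_translate, inv_inv, mul_one]; exact hw
  · intro k' hk'
    rw [translate, inv_inv] at hk'
    have := hmin _ hk'
    rwa [show (k * k')⁻¹ * t * (k * k') = k'⁻¹ * (k⁻¹ * t * k) * k' by group] at this

end free
end BipartiteSeparatedGraph

theorem theorem10p6 {V₀ V₁ E : Type*} [Finite V₀] [Finite V₁] [Finite E]
    (G : BipartiteSeparatedGraph V₀ V₁ E) :
    G.canonicalPartialAction.IsTopologicallyFree ↔ G.ConditionL :=
  ⟨BipartiteSeparatedGraph.conditionL_of_isTopologicallyFree,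
    BipartiteSeparatedGraph.isTopologicallyFree_of_conditionL⟩
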